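/- Let $\pi=(\pi^{ij})$ be a smooth Poisson tensor on $M=\mathbb{R}^d$ with $\pi^{ij}=\{x^i,x^j\}$, and let $H\in C^\infty(M)$. Write $(x,p)$ for the canonical coordinates of $T^*M=\mathbb{R}^d\times\mathbb{R}^d$. **Karasev map.** Let $\overline V(x,p)=-\pi^{ij}(x)p_i\,\partial_{x^j}$ be the flat Poisson spray on $T^*M$, with flow $\varphi^{\overline V}_s$, and let $\phi_\epsilon(x,p)=\frac1\epsilon\int_0^\epsilon x\big(\varphi^{\overline V}_s(x,p)\big)\,ds$ (with $\phi_0(x,p)=x$), wherever the flow is defined. There is a smooth map $(\epsilon,x,p)\mapsto\alpha_\epsilon(x,p)\in M$, defined on an open neighbourhood $U$ of $\{\epsilon=0\}\cup\{p=0\}$ in $\mathbb{R}\times T^*M$, with $\phi_\epsilon(\alpha_\epsilon(x,p),p)=x$ on $U$. Fix any such map, and put $\beta_\epsilon(x,p)=\alpha_\epsilon(x,-p)$. For $n\ge 0$ let $\hat\alpha_\epsilon=\sum_{k\le n}\frac{\epsilon^k}{k!}\partial_\epsilon^k\alpha|_{\epsilon=0}$ and $\hat\beta_\epsilon=\sum_{k\le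 n}\frac{\epsilon^k}{k!}\partial_\epsilon^k\beta|_{\epsilon=0}$ be the Taylor truncations of order $n$ in $\epsilon$. **Generating function.** For each $\epsilon$ let $h\mapsto c_\epsilon(h)$ be an arbitrary smooth function, and for $m\ge 0$ let $\hat S_{\epsilon,h}=\sum_{l=0}^m S_{\epsilon,(l)}h^l$, where $S_{\epsilon,(0)}=0$ and the other coefficients $S_{\epsilon,(l)}\in C^\infty(M)$ are given by the recursion that results from expanding at $h=0$ both sides of the Hamilton–Jacobi equation $$\partial_hS_{\epsilon,h}(x)=H\big(\alpha_\epsilon(x,dS_{\epsilon,h}(x))\big)+c_\epsilon(h),\qquad S_{\epsilon,0}=0.$$ Whenever $S_{\epsilon,h}$ is a smooth solution of this problem on a neighbourhood of $\{h=0\}$, $\hat S_{\epsilon,h}$ is its Taylor truncation of order $m$ in $h$. **The integrator.** For an open set $W\subseteq M$ let $L_{\epsilon,h}=\{(x,d\hat S_{\epsilon,h}(x)):x\in W\}$ be the part of $graph(d\hat S_{\epsilon,h})$ over $W$. It is a *local bisection* if $\hat\alpha_\epsilon|_{L_{\epsilon,h}}$ and $\hat\beta_\epsilon|_{L_{\epsilon,h}}$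 are diffeomorphisms onto open subsets of $M$, and a *bisection* if these subsets are both $M$. The K-HJ Poisson integrator is the map $$M^{KHJ}_{\epsilon,h}=\hat\alpha_\epsilon\circ\big(\hat\beta_\epsilon|_{L_{\epsilon,h}}\big)^{-1}:\ \hat\beta_\epsilon(L_{\epsilon,h})\to M .$$ Then, for all $n,m\ge 0$: 1. For every compact $K\subset M$ there are an open $W\supseteq K$ and $\delta>0$ such that, for all $|\epsilon|,|h|<\delta$, $L_{\epsilon,h}$ is a local bisection and $K\subseteq\hat\beta_\epsilon(L_{\epsilon,h})$, so that $M^{KHJ}_{\epsilon,h}$ is defined on $K$. 2. (Self-adjointness.) For all real $\epsilon,h$ and every open $W$ such that $L_{\epsilon,h}$ is a local bisection, $L_{\epsilon,-h}$ is a local bisection too, $M^{KHJ}_{\epsilon,-h}$ is a bijection from $\hat\beta_\epsilon(L_{\epsilon,-h})$ onto $\hat\beta_\epsilon(L_{\epsilon,h})$, and $$\big(M^{KHJ}_{\epsilon,h}\big)^*:=\big(M^{KHJ}_{\epsilon,-h}\big)^{-1}=M^{KHJ}_{\epsilon,h}\quad\text{on }\hat\beta_\epsilon(L_{\epsilon,h}).$$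 In particular, if $W=M$ and $L_{\epsilon,h}$ is a bisection, then so is $L_{\epsilon,-h}$, and $M^{KHJ}_{\epsilon,\pm h}$ are mutually inverse bijections $M\to M$. -/

import Mathlib

open scoped ContDiff

namespace KHJ

/-- The manifold `M = ℝ^d` with its linear coordinates `x^i`. The same type is used for the
components `p_i` of a covector, so that `T*M` is `Coord d × Coord d` with coordinates `(x, p)`. -/
abbrev Coord (d : ℕ) := Fin d → ℝ

/-- The differential of `f` at `x`, as the covector with components `∂f/∂x^i`. -/
noncomputable def differential {d : ℕ} (f : Coord d → ℝ) (x : Coord d) : Coord d :=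
  fun i => fderiv ℝ f x (Pi.single i 1)

/-- A Poisson tensor on `ℝ^d`, given by its components `π^{ij} = {x^i, x^j}`. -/
structure IsPoissonTensor {d : ℕ} (π : Coord d → Matrix (Fin d) (Fin d) ℝ) : Prop where
  smooth : ∀ i j, ContDiff ℝ ∞ (fun x => π x i j)
  skew : ∀ x i j, π x j i = -π x i j
  jacobi : ∀ x i j k,
    ∑ l, (π x i l * differential (fun y => π y j k) x l
        + π x j l * differential (fun y => π y k i) x l
        + π x k l * differential (fun y => π y i j) x l) = 0

/-- The flat Poisson spray `V(x,p) = -π^{ij}(x) p_i ∂/∂x^j` on `T*M`. -/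
def spray {d : ℕ} (π : Coord d → Matrix (Fin d) (Fin d) ℝ) (z : Coord d × Coord d) :
    Coord d × Coord d :=
  (fun j => -∑ i, π z.1 i j * z.2 i, 0)

/-- `φ_ε(y,p) = x`: the integral curve of the spray through `(y,p)` is defined on the whole time
interval between `0` and `ε`, and the average `ε⁻¹ ∫_0^ε x(s) ds` of its `x`-component is `x`
(for `ε = 0` the average is its limiting value `y`). -/
def IsXAverage {d : ℕ} (π : Coord d → Matrix (Fin d) (Fin d) ℝ) (ε : ℝ) (y p x : Coord d) : Prop :=
  ∃ γ : ℝ → Coord d × Coord d, γ 0 = (y, p) ∧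
    IsIntegralCurveOn γ (fun _ => spray π) (Set.uIcc 0 ε) ∧
    x = if ε = 0 then y else ε⁻¹ • ∫ s in (0 : ℝ)..ε, (γ s).1

/-- `α` is the Karasev map `(ε, x, p) ↦ α_ε(x, p)`: a smooth map on a neighbourhood `U` of
`{ε = 0} ∪ {p = 0}` (so that `U_ε = {(x,p) | (ε,x,p) ∈ U}` is a neighbourhood of the zero section)
which solves the implicit relation `φ_ε(α_ε(x,p), p) = x`. -/
structure IsKarasevMap {d : ℕ} (π : Coord d → Matrix (Fin d) (Fin d) ℝ)
    (U : Set (ℝ × Coord d × Coord d)) (α : ℝ → Coord d → Coord d → Coord d) : Prop where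
  isOpen : IsOpen U
  zero_mem : ∀ x p, ((0 : ℝ), x, p) ∈ U
  section_mem : ∀ ε x, (ε, x, (0 : Coord d)) ∈ U
  smooth : ContDiffOn ℝ ∞ (fun w : ℝ × Coord d × Coord d => α w.1 w.2.1 w.2.2) U
  relation : ∀ ε x p, (ε, x, p) ∈ U → IsXAverage π ε (α ε x p) p x

/-- The truncation `τ^n[f_ε](z) = ∑_{k ≤ n} ε^k/k! ∂_ε^k f|_{(z,0)}` of a family `f_ε(z)`. -/
noncomputable def truncation {X : Type*} {d : ℕ} (n : ℕ) (f : ℝ → X → Coord d) (ε : ℝ) (z : X) :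
    Coord d :=
  ∑ k ∈ Finset.range (n + 1), (ε ^ k / (k.factorial : ℝ)) • iteratedDeriv k (fun e => f e z) 0

/-- The approximate source map: the order `n` truncation of `α_ε`. -/
noncomputable def alphaHat {d : ℕ} (α : ℝ → Coord d → Coord d → Coord d) (n : ℕ) (ε : ℝ) :
    Coord d × Coord d → Coord d :=
  truncation n (fun e z => α e z.1 z.2) ε

/-- The approximate target map: the order `n` truncation of `β_ε(x,p) = α_ε(x,-p)`. -/
noncomputable def betaHat {d : ℕ} (α : ℝ → Coord d → Coord d → Coord d) (n : ℕ) (ε : ℝ) :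
    Coord d × Coord d → Coord d :=
  truncation n (fun e z => α e z.1 (-z.2)) ε

/-- `S = (S_h)` is an exact solution, near `h = 0`, of the Hamilton-Jacobi equation
`∂_h S_h(x) = H(α_ε(x, dS_h(x))) + c(h)` with `S_0 = 0`. -/
structure IsHJSolution {d : ℕ} (U : Set (ℝ × Coord d × Coord d))
    (α : ℝ → Coord d → Coord d → Coord d) (H : Coord d → ℝ) (ε : ℝ) (c : ℝ → ℝ)
    (N : Set (ℝ × Coord d)) (S : ℝ → Coord d → ℝ) : Prop where
  isOpen : IsOpen N
  zero_mem : ∀ x, ((0 : ℝ), x) ∈ N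
  smooth : ContDiffOn ℝ ∞ (fun w : ℝ × Coord d => S w.1 w.2) N
  initial : ∀ x, S 0 x = 0
  domain : ∀ h x, (h, x) ∈ N → (ε, x, differential (S h) x) ∈ U
  equation : ∀ h x, (h, x) ∈ N →
    HasDerivAt (fun t => S t x) (H (α ε x (differential (S h) x)) + c h) h

/-- The generating function `Ŝ_{ε,h} = ∑_{l ≤ m} S_{ε,(l)} h^l` of order `m`, with the
coefficients obtained recursively by expanding both sides of the Hamilton-Jacobi equation at
`h = 0`: `S_{ε,(0)} = 0`, and `(m+1) S_{ε,(m+1)}(x)` is the coefficient of `h^m` in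
`H(α_ε(x, dŜ(x))) + c(h)`, where `Ŝ` is the generating function of order `m`. -/
noncomputable def hjTrunc {d : ℕ} (α : ℝ → Coord d → Coord d → Coord d) (H : Coord d → ℝ)
    (ε : ℝ) (c : ℝ → ℝ) : ℕ → ℝ → Coord d → ℝ
  | 0 => fun _ _ => 0
  | m + 1 => fun h x => hjTrunc α H ε c m h x +
      h ^ (m + 1) / ((m + 1).factorial : ℝ) *
        iteratedDeriv m
          (fun t => H (α ε x (differential (hjTrunc α H ε c m t) x)) + c t) 0

/-- The part of `graph(dS) ⊆ T*M` which lies over `W`. -/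
def graphD {d : ℕ} (S : Coord d → ℝ) (W : Set (Coord d)) : Set (Coord d × Coord d) :=
  (fun x => (x, differential S x)) '' W

/-- For a smooth map `f : T*M → M`: the set `L` is an embedded submanifold and the restriction
`f|_L : L → f(L)` is a diffeomorphism onto an open subset of `M`, that is, it has a smooth
inverse on `f(L)`. -/
def IsDiffeoOnto {d : ℕ} (f : Coord d × Coord d → Coord d) (L : Set (Coord d × Coord d)) : Prop :=
  ContDiff ℝ ∞ f ∧ IsOpen (f '' L) ∧
    ∃ s : Coord d → Coord d × Coord d, ContDiffOn ℝ ∞ s (f '' L) ∧ ∀ z ∈ L, s (f z) = z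

/-- `L` is a local bisection for the maps `a, b : T*M → M`. -/
def IsLocalBisection {d : ℕ} (a b : Coord d × Coord d → Coord d) (L : Set (Coord d × Coord d)) :
    Prop :=
  IsDiffeoOnto a L ∧ IsDiffeoOnto b L

/-- `L` is a (global) bisection for the maps `a, b : T*M → M`. -/
def IsBisection {d : ℕ} (a b : Coord d × Coord d → Coord d) (L : Set (Coord d × Coord d)) : Prop :=
  IsLocalBisection a b L ∧ a '' L = Set.univ ∧ b '' L = Set.univ

/-- The induced map `a ∘ (b|_L)⁻¹`, with domain `b(L)`. -/
noncomputable def inducedMap {d : ℕ} (a b : Coord d × Coord d → Coord d)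
    (L : Set (Coord d × Coord d)) (x : Coord d) : Coord d :=
  a (Function.invFunOn b L x)

/-- The Lagrangian `graph(dŜ_{ε,h})` over `W`. -/
noncomputable def lagr {d : ℕ} (α : ℝ → Coord d → Coord d → Coord d) (H : Coord d → ℝ)
    (c : ℝ → ℝ → ℝ) (m : ℕ) (W : Set (Coord d)) (ε h : ℝ) : Set (Coord d × Coord d) :=
  graphD (hjTrunc α H ε (c ε) m h) W

/-- The K-HJ Poisson integrator `α̂_ε ∘ (β̂_ε|_L)⁻¹`, where `L` is the part of
`graph(dŜ_{ε,h})` over `W`. -/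
noncomputable def khjMap {d : ℕ} (α : ℝ → Coord d → Coord d → Coord d) (H : Coord d → ℝ)
    (c : ℝ → ℝ → ℝ) (n m : ℕ) (W : Set (Coord d)) (ε h : ℝ) : Coord d → Coord d :=
  inducedMap (alphaHat α n ε) (betaHat α n ε) (lagr α H c m W ε h)

/-- The domain `β̂_ε(L)` of the K-HJ Poisson integrator. -/
noncomputable def khjDomain {d : ℕ} (α : ℝ → Coord d → Coord d → Coord d) (H : Coord d → ℝ)
    (c : ℝ → ℝ → ℝ) (n m : ℕ) (W : Set (Coord d)) (ε h : ℝ) : Set (Coord d) :=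
  betaHat α n ε '' lagr α H c m W ε h

/-- The adjoint method `(M_{-h})⁻¹` of a method `M_h : D_h → M`. -/
noncomputable def adjointMethod {d : ℕ} (M : ℝ → Coord d → Coord d) (D : ℝ → Set (Coord d))
    (h : ℝ) : Coord d → Coord d :=
  Function.invFunOn (M (-h)) (D (-h))

end KHJ

/-!
Orbits of the Poisson spray on `[0, 1]` with prescribed mean `x` and constant momentum `q = ε p`
solve an equation in the Banach space of continuous paths whose linearization at `q = 0` is
invertible, so near the constant orbits they form a smooth family `A(x, q)` without competitors.
The starting point `A(x, ε p)(0)` is `α_ε(x, p)`; by uniqueness and time reversal, the end point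
`A(x, ε p)(1)` is `β_ε(x, p) = α_ε(x, -p)`.

By the Jacobi identity `π` is transported along an orbit by the linearized flow. Integrating the
derivative of the orbit with respect to `q` by parts over `[0, 1]` then shows that `α_ε^* H` and
`β_ε^* H` commute for the canonical bracket near the zero section. Hence the difference of their
restrictions to `graph(dŜ_h)` is transported in `h`, up to the residual of the Hamilton–Jacobi
equation, and vanishes to order `m`. Exchanging them amounts to `p ↦ -p`, so inductively the even
coefficients of `Ŝ` have no differential: `dŜ_{-h} = -dŜ_h`. Self-adjointness follows because
`p ↦ -p` maps `L_{ε,h}` to `L_{ε,-h}` and exchanges `α̂` and `β̂`.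

For small `ε` and `h` the maps `x ↦ α̂(x, dŜ(x))` and `x ↦ β̂(x, dŜ(x))` are `C¹`-close to the
identity near a compact set, hence diffeomorphisms onto open sets that contain it.
-/

namespace KHJ

open Filter Topology

/-! ### Taylor coefficients in one variable of a function of several variables -/

section Jets

theorem eventually_slice {T Y : Type*} [TopologicalSpace T] [TopologicalSpace Y] {P : T × Y → Prop}
    {t : T} {y : Y} (h : ∀ᶠ z in 𝓝 (t, y), P z) : ∀ᶠ s in 𝓝 t, P (s, y) :=
  (Continuous.prodMk_left y).continuousAt.eventually h

variable {E X F G : Type*} [NormedAddCommGroup E] [NormedSpace ℝ E]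
  [NormedAddCommGroup X] [NormedSpace ℝ X] [NormedAddCommGroup F] [NormedSpace ℝ F]
  [NormedAddCommGroup G] [NormedSpace ℝ G]

/-- The directional derivative of `f` along the constant vector field `v`. -/
noncomputable def dirDeriv (v : E) (f : E → F) (z : E) : F := fderiv ℝ f z v

/-- Smoothness of `f(t, x)` at all points of `{t = 0}`; this is what Taylor expansion in `t` at
`t = 0`, uniformly in `x`, requires. -/
def SmoothAtZero (f : ℝ × X → F) : Prop := ∀ x, ContDiffAt ℝ ∞ f (0, x)

/-- The `j`-th derivative of `f(t, x)` in `t` at `t = 0`. -/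
noncomputable def jet (j : ℕ) (f : ℝ × X → F) (x : X) : F :=
  iteratedDeriv j (fun t => f (t, x)) 0

theorem contDiffAt_dirDeriv {f : E → F} {z : E} {m n : ℕ∞ω} (h : ContDiffAt ℝ n f z)
    (hmn : m + 1 ≤ n) (v : E) : ContDiffAt ℝ m (dirDeriv v f) z :=
  (h.fderiv_right hmn).clm_apply contDiffAt_const

theorem eventually_differentiableAt {f : E → F} {z : E} {n : ℕ∞ω} (h : ContDiffAt ℝ n f z)
    (hn : 1 ≤ n) : ∀ᶠ w in 𝓝 z, DifferentiableAt ℝ f w := by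
  have h1 : ContDiffAt ℝ 1 f z := h.of_le hn
  filter_upwards [h1.eventually (by simp)] with w hw using hw.differentiableAt (by simp)

theorem dirDeriv_comm {f : E → F} {z : E} (h : ContDiffAt ℝ 2 f z) (v w : E) :
    dirDeriv v (dirDeriv w f) z = dirDeriv w (dirDeriv v f) z := by
  have hd : DifferentiableAt ℝ (fderiv ℝ f) z :=
    (h.fderiv_right (m := 1) (by norm_num)).differentiableAt (by simp)
  have second : ∀ a b : E, dirDeriv b (dirDeriv a f) z = fderiv ℝ (fderiv ℝ f) z b a := by
    intro a b
    change fderiv ℝ (fun z => fderiv ℝ f z a) z b = _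
    rw [fderiv_clm_apply hd (differentiableAt_const a)]
    simp
  rw [second, second]
  exact h.isSymmSndFDerivAt (by simp) v w

theorem eventually_dirDeriv_comm {f : E → F} {z : E} (h : ContDiffAt ℝ ∞ f z) (v w : E) :
    dirDeriv v (dirDeriv w f) =ᶠ[𝓝 z] dirDeriv w (dirDeriv v f) := by
  have h2 : ContDiffAt ℝ 2 f z := h.of_le (by norm_cast)
  filter_upwards [h2.eventually (by simp)] with y hy using dirDeriv_comm hy v w

theorem deriv_slice {f : ℝ × X → F} {t : ℝ} {x : X} (h : DifferentiableAt ℝ f (t, x)) :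
    deriv (fun s => f (s, x)) t = dirDeriv (1, 0) f (t, x) :=
  (h.hasFDerivAt.comp_hasDerivAt t ((hasDerivAt_id t).prodMk (hasDerivAt_const t x))).deriv

theorem fderiv_slice {f : E × X → F} {t : E} {x : X} (h : DifferentiableAt ℝ f (t, x)) (v : X) :
    fderiv ℝ (fun y => f (t, y)) x v = dirDeriv (0, v) f (t, x) :=
  congrArg (fun L : X →L[ℝ] F => L v)
    (h.hasFDerivAt.comp x (hasFDerivAt_prodMk_right (𝕜 := ℝ) t x)).fderiv

namespace SmoothAtZero

theorem slice {f : ℝ × X → F} (h : SmoothAtZero f) (x : X) :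
    ContDiffAt ℝ ∞ (fun t => f (t, x)) 0 :=
  (h x).comp (0 : ℝ) (f := fun t => (t, x)) (by fun_prop)

theorem dirDeriv {f : ℝ × X → F} (h : SmoothAtZero f) (v : ℝ × X) :
    SmoothAtZero (dirDeriv v f) := fun x => contDiffAt_dirDeriv (h x) (by simp) v

theorem sub {f g : ℝ × X → F} (hf : SmoothAtZero f) (hg : SmoothAtZero g) :
    SmoothAtZero (fun z => f z - g z) := fun x => (hf x).sub (hg x)

theorem mul {f g : ℝ × X → ℝ} (hf : SmoothAtZero f) (hg : SmoothAtZero g) :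
    SmoothAtZero (fun z => f z * g z) := fun x => (hf x).mul (hg x)

theorem sum {ι : Type*} {s : Finset ι} {f : ι → ℝ × X → F} (hf : ∀ i, SmoothAtZero (f i)) :
    SmoothAtZero (fun z => ∑ i ∈ s, f i z) := fun x => ContDiffAt.sum fun i _ => hf i x

end SmoothAtZero

theorem jet_congr {Y : Type*} [TopologicalSpace Y] {f g : ℝ × Y → F} {x : Y}
    (h : f =ᶠ[𝓝 (0, x)] g) (j : ℕ) : jet j f x = jet j g x :=
  Filter.EventuallyEq.iteratedDeriv_eq j (eventually_slice h)

theorem jet_zero {Y : Type*} (f : ℝ × Y → F) : jet 0 f = fun x => f (0, x) := by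
  funext x
  simp [jet]

theorem jet_succ {f : ℝ × X → F} (h : SmoothAtZero f) (j : ℕ) :
    jet (j + 1) f = jet j (dirDeriv (1, 0) f) := by
  funext x
  unfold jet
  rw [iteratedDeriv_succ']
  apply Filter.EventuallyEq.iteratedDeriv_eq
  filter_upwards [eventually_slice (eventually_differentiableAt (h x) (by simp))] with t ht
  exact deriv_slice ht

theorem jet_add {f g : ℝ × X → F} (hf : SmoothAtZero f) (hg : SmoothAtZero g) (j : ℕ) (x : X) :
    jet j (fun z => f z + g z) x = jet j f x + jet j g x :=
  iteratedDeriv_fun_add ((hf.slice x).of_le (mod_cast le_top))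
    ((hg.slice x).of_le (mod_cast le_top))

theorem jet_sub {f g : ℝ × X → F} (hf : SmoothAtZero f) (hg : SmoothAtZero g) (j : ℕ) (x : X) :
    jet j (fun z => f z - g z) x = jet j f x - jet j g x :=
  iteratedDeriv_fun_sub ((hf.slice x).of_le (mod_cast le_top))
    ((hg.slice x).of_le (mod_cast le_top))

theorem jet_sum {ι : Type*} {s : Finset ι} {f : ι → ℝ × X → F} (hf : ∀ i, SmoothAtZero (f i))
    (j : ℕ) (x : X) : jet j (fun z => ∑ i ∈ s, f i z) x = ∑ i ∈ s, jet j (f i) x :=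
  iteratedDeriv_fun_sum fun i _ => ((hf i).slice x).of_le (mod_cast le_top)

theorem jet_mul_eq_zero {f g : ℝ × X → ℝ} (hf : SmoothAtZero f) (hg : SmoothAtZero g)
    {m : ℕ} {x : X} (h : ∀ j ≤ m, jet j g x = 0) : jet m (fun z => f z * g z) x = 0 := by
  have leibniz := iteratedDeriv_mul (n := m) ((hf.slice x).of_le (mod_cast le_top))
    ((hg.slice x).of_le (mod_cast le_top))
  refine leibniz.trans (Finset.sum_eq_zero fun i _ => ?_)
  rw [show iteratedDeriv (m - i) (fun t => g (t, x)) 0 = 0 from h _ (Nat.sub_le _ _), mul_zero]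

theorem jet_of_comp_neg {Y : Type*} {f g : ℝ × Y → F} (h : ∀ t y, g (t, y) = f (-t, y))
    (j : ℕ) (x : Y) :
    jet j g x = (-1 : ℝ) ^ j • jet j f x := by
  simp only [jet, h]
  simpa using iteratedDeriv_comp_neg j (fun t => f (t, x)) 0

theorem contDiff_jet {f : ℝ × X → F} (h : SmoothAtZero f) (j : ℕ) : ContDiff ℝ ∞ (jet j f) := by
  induction j generalizing f with
  | zero =>
    rw [jet_zero, contDiff_iff_contDiffAt]
    exact fun x => (h x).comp x (f := fun y : X => ((0 : ℝ), y)) (by fun_prop)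
  | succ j ih =>
    rw [jet_succ h]
    exact ih (h.dirDeriv _)

theorem fderiv_jet {f : ℝ × X → F} (h : SmoothAtZero f) (j : ℕ) (x v : X) :
    fderiv ℝ (jet j f) x v = jet j (dirDeriv (0, v) f) x := by
  induction j generalizing f with
  | zero =>
    rw [jet_zero, jet_zero]
    exact fderiv_slice ((h x).differentiableAt (by simp)) v
  | succ j ih =>
    rw [jet_succ h, ih (h.dirDeriv _), jet_succ (h.dirDeriv _)]
    exact jet_congr (eventually_dirDeriv_comm (h x) _ _) j

theorem iteratedDeriv_comp_congr {u v : ℝ → F} {g : F → G} {t : ℝ} {m : ℕ}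
    (hu : ContDiffAt ℝ ∞ u t) (hv : ContDiffAt ℝ ∞ v t) (hg : ContDiffAt ℝ ∞ g (u t))
    (h : ∀ j ≤ m, iteratedDeriv j u t = iteratedDeriv j v t) :
    iteratedDeriv m (g ∘ u) t = iteratedDeriv m (g ∘ v) t := by
  have h0 : u t = v t := by simpa using h 0 (Nat.zero_le _)
  rw [iteratedDeriv_vcomp_eq_sum_orderedFinpartition hg hu (mod_cast le_top),
    iteratedDeriv_vcomp_eq_sum_orderedFinpartition (h0 ▸ hg) hv (mod_cast le_top), h0]
  refine Finset.sum_congr rfl fun c _ => ?_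
  congr 1
  funext i
  exact h _ (c.partSize_le i)

theorem iteratedDeriv_sum_pow_div_factorial (a : ℕ → ℝ) (m j : ℕ) :
    iteratedDeriv j (fun t : ℝ => ∑ l ∈ Finset.range m, t ^ l / (l.factorial : ℝ) * a l) 0 =
      if j < m then a j else 0 := by
  have monomial : ∀ l, iteratedDeriv j (fun t : ℝ => t ^ l / (l.factorial : ℝ) * a l) 0 =
      if j = l then a l else 0 := by
    intro l
    rw [show (fun t : ℝ => t ^ l / (l.factorial : ℝ) * a l) =
      fun t => t ^ l * (a l / (l.factorial : ℝ)) by funext t; ring]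
    rw [iteratedDeriv_mul_const_field, iteratedDeriv_fun_pow_zero]
    split_ifs
    · have : (l.factorial : ℝ) ≠ 0 := by positivity
      field_simp
    · simp
  rw [iteratedDeriv_fun_sum (fun i _ => by fun_prop)]
  simp [monomial]

end Jets

/-! ### The truncated Hamilton–Jacobi recursion -/

section HamiltonJacobi

open Function

variable {d : ℕ}

theorem differential_zero (x : Coord d) : differential 0 x = 0 := by
  funext i
  simp [differential]

theorem differential_neg (f : Coord d → ℝ) (x : Coord d) :
    differential (-f) x = -differential f x := by
  funext i
  simp [differential, fderiv_neg]

theorem differential_add_const (f : Coord d → ℝ) (k : ℝ) (x : Coord d) :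
    differential (fun y => f y + k) x = differential f x := by
  funext i
  simp [differential]

/-- The differential `d_x S_y(x)` of a family `S_y(x)` in its second variable only; for a generating
function `S` its graph is the family of Lagrangians `graph(dS_y)`. -/
noncomputable def spatialDifferential {Y : Type*} (S : Y × Coord d → ℝ) (z : Y × Coord d) :
    Coord d :=
  differential (fun y => S (z.1, y)) z.2

theorem spatialDifferential_eq_zero {Y : Type*} {S : Y × Coord d → ℝ} {y : Y}
    (h : ∀ x, S (y, x) = 0) (x : Coord d) : spatialDifferential S (y, x) = 0 := by
  rw [spatialDifferential, show (fun x => S (y, x)) = 0 from funext h]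
  exact differential_zero x

theorem spatialDifferential_apply {Y : Type*} [NormedAddCommGroup Y] [NormedSpace ℝ Y]
    {S : Y × Coord d → ℝ} {z : Y × Coord d} (h : DifferentiableAt ℝ S z) (i : Fin d) :
    spatialDifferential S z i = dirDeriv (0, Pi.single i 1) S z :=
  fderiv_slice h _

theorem contDiffAt_spatialDifferential {Y : Type*} [NormedAddCommGroup Y] [NormedSpace ℝ Y]
    {S : Y × Coord d → ℝ} {z : Y × Coord d} {m n : ℕ∞ω} (h : ContDiffAt ℝ n S z)
    (hmn : m + 1 ≤ n) : ContDiffAt ℝ m (spatialDifferential S) z := by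
  refine contDiffAt_pi.2 fun i =>
    (contDiffAt_dirDeriv h hmn (0, Pi.single i 1)).congr_of_eventuallyEq ?_
  filter_upwards [eventually_differentiableAt h (le_add_self.trans hmn)] with w hw
  exact spatialDifferential_apply hw i

theorem SmoothAtZero.spatialDifferential {S : ℝ × Coord d → ℝ} (h : SmoothAtZero S) :
    SmoothAtZero (spatialDifferential S) := fun x => contDiffAt_spatialDifferential (h x) (by simp)

theorem iteratedDeriv_apply {u : ℝ → Coord d} {t : ℝ} {j : ℕ} (hu : ContDiffAt ℝ j u t)
    (i : Fin d) : iteratedDeriv j u t i = iteratedDeriv j (fun s => u s i) t :=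
  (congrArg (fun L => L (fun _ => (1 : ℝ)))
    ((ContinuousLinearMap.proj (R := ℝ) (φ := fun _ : Fin d => ℝ) i).iteratedFDeriv_comp_left
      (i := j) hu le_rfl)).symm

theorem jet_spatialDifferential {S : ℝ × Coord d → ℝ} (h : SmoothAtZero S) (j : ℕ) (x : Coord d) :
    jet j (spatialDifferential S) x = differential (jet j S) x := by
  funext i
  rw [differential, fderiv_jet h, jet,
    iteratedDeriv_apply ((h.spatialDifferential.slice x).of_le (mod_cast le_top))]
  apply jet_congr (f := fun z => spatialDifferential S z i)
  filter_upwards [eventually_differentiableAt (h x) (by simp)] with z hz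
  exact spatialDifferential_apply hz i

/-- The restriction of a function `a` on `T*M` to the family of Lagrangians `graph(dS_y)`, in the
coordinates `(y, x)`. For `a = α_ε^* H` it is the `S`-dependent part of the right hand side of the
Hamilton–Jacobi equation. -/
noncomputable def alongGraph {Y : Type*} (a : Coord d × Coord d → ℝ) (S : Y × Coord d → ℝ)
    (z : Y × Coord d) : ℝ :=
  a (z.2, spatialDifferential S z)

theorem SmoothAtZero.alongGraph {a : Coord d × Coord d → ℝ} {S : ℝ × Coord d → ℝ}
    (ha : ∀ x, ContDiffAt ℝ ∞ a (x, 0)) (hS : SmoothAtZero S) (h0 : ∀ x, S (0, x) = 0) :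
    SmoothAtZero (alongGraph a S) := fun x => by
  refine ContDiffAt.comp (0, x) (f := fun z : ℝ × Coord d => (z.2, KHJ.spatialDifferential S z)) ?_
    (contDiffAt_snd.prodMk (hS.spatialDifferential x))
  rw [spatialDifferential_eq_zero h0]
  exact ha x

theorem jet_alongGraph_congr {a : Coord d × Coord d → ℝ} {S R : ℝ × Coord d → ℝ}
    (ha : ∀ x, ContDiffAt ℝ ∞ a (x, 0)) (hS : SmoothAtZero S) (hR : SmoothAtZero R)
    (h0 : ∀ x, S (0, x) = 0) {m : ℕ} (h : ∀ j ≤ m, jet j S = jet j R) :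
    jet m (alongGraph a S) = jet m (alongGraph a R) := by
  funext x
  refine iteratedDeriv_comp_congr (g := fun p => a (x, p)) (hS.spatialDifferential.slice x)
    (hR.spatialDifferential.slice x) ?_ fun j hj => ?_
  · rw [spatialDifferential_eq_zero h0]
    exact (ha x).comp (0 : Coord d) (f := fun p => (x, p)) (by fun_prop)
  · exact (jet_spatialDifferential hS j x).trans
      ((congrArg (differential · x) (h j hj)).trans (jet_spatialDifferential hR j x).symm)

theorem jet_alongGraph_add {a : Coord d × Coord d → ℝ} {S : ℝ × Coord d → ℝ} {c : ℝ → ℝ}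
    (ha : ∀ x, ContDiffAt ℝ ∞ a (x, 0)) (hS : SmoothAtZero S) (h0 : ∀ x, S (0, x) = 0)
    (hc : ContDiff ℝ ∞ c) (l : ℕ) (x : Coord d) :
    jet l (fun z => alongGraph a S z + c z.1) x = jet l (alongGraph a S) x + iteratedDeriv l c 0 :=
  jet_add (hS.alongGraph ha h0) (g := fun z => c z.1)
    (fun _ => hc.contDiffAt.comp (_ : ℝ × Coord d) contDiffAt_fst) l x

/-- Joint smoothness of `H(α_ε(x, p))` at the zero section. -/
def SmoothAtSection (α : ℝ → Coord d → Coord d → Coord d) (H : Coord d → ℝ) : Prop :=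
  ∀ ε x, ContDiffAt ℝ ∞ (fun w : ℝ × Coord d × Coord d => H (α w.1 w.2.1 w.2.2)) (ε, x, 0)

/-- The pullback `α_ε^* H`. -/
def sourcePullback (α : ℝ → Coord d → Coord d → Coord d) (H : Coord d → ℝ) (ε : ℝ)
    (z : Coord d × Coord d) : ℝ :=
  H (α ε z.1 z.2)

/-- The derivatives `l! S_(l)` at `h = 0` of the generating function. -/
noncomputable def hjCoef (α : ℝ → Coord d → Coord d → Coord d) (H : Coord d → ℝ)
    (ε : ℝ) (c : ℝ → ℝ) : ℕ → Coord d → ℝ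
  | 0 => 0
  | l + 1 => jet l fun z =>
      alongGraph (sourcePullback α H ε) (uncurry (hjTrunc α H ε c l)) z + c z.1

variable {α : ℝ → Coord d → Coord d → Coord d} {H : Coord d → ℝ}

theorem SmoothAtSection.comp_spatialDifferential (hs : SmoothAtSection α H) {Y : Type*}
    [NormedAddCommGroup Y] [NormedSpace ℝ Y] {e : Y → ℝ} {S : Y × Coord d → ℝ} {z : Y × Coord d}
    (he : ContDiffAt ℝ ∞ e z.1) (hS : ContDiffAt ℝ ∞ S z) (h0 : spatialDifferential S z = 0) :
    ContDiffAt ℝ ∞ (fun z => H (α (e z.1) z.2 (spatialDifferential S z))) z := by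
  refine ContDiffAt.comp z (f := fun z : Y × Coord d => (e z.1, z.2, spatialDifferential S z))
    (g := fun w : ℝ × Coord d × Coord d => H (α w.1 w.2.1 w.2.2)) ?_
    ((he.comp z contDiffAt_fst).prodMk (contDiffAt_snd.prodMk
      (contDiffAt_spatialDifferential hS (by simp))))
  rw [h0]
  exact hs _ _

theorem SmoothAtSection.sourcePullback (hs : SmoothAtSection α H) (ε : ℝ) (x : Coord d) :
    ContDiffAt ℝ ∞ (sourcePullback α H ε) (x, 0) :=
  (hs ε x).comp (x, (0 : Coord d)) (f := fun z : Coord d × Coord d => (ε, z.1, z.2)) (by fun_prop)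

theorem hjTrunc_eq_sum (ε : ℝ) (c : ℝ → ℝ) (m : ℕ) (h : ℝ) (x : Coord d) :
    hjTrunc α H ε c m h x =
      ∑ l ∈ Finset.range (m + 1), h ^ l / (l.factorial : ℝ) * hjCoef α H ε c l x := by
  induction m with
  | zero => simp [hjTrunc, hjCoef]
  | succ m ih => rw [Finset.sum_range_succ, ← ih]; rfl

theorem hjTrunc_zero_right (ε : ℝ) (c : ℝ → ℝ) (m : ℕ) (x : Coord d) :
    hjTrunc α H ε c m 0 x = 0 := by
  rw [hjTrunc_eq_sum, Finset.sum_range_succ']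
  simp [hjCoef]

theorem jet_hjTrunc (ε : ℝ) (c : ℝ → ℝ) {m j : ℕ} (hj : j ≤ m) :
    jet j (uncurry (hjTrunc α H ε c m)) = hjCoef α H ε c j := by
  funext x
  simp only [jet, uncurry, hjTrunc_eq_sum]
  rw [iteratedDeriv_sum_pow_div_factorial (fun l => hjCoef α H ε c l x), if_pos (by omega)]

theorem contDiff_uncurry_hjTrunc_of_hjCoef {m : ℕ}
    (h : ∀ l ≤ m, ContDiff ℝ ∞ (fun z : ℝ × Coord d => hjCoef α H z.1 0 l z.2)) :
    ContDiff ℝ ∞ (fun z : (ℝ × ℝ) × Coord d => hjTrunc α H z.1.2 0 m z.1.1 z.2) := by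
  simp_rw [hjTrunc_eq_sum]
  refine ContDiff.sum fun l hl => ContDiff.mul (by fun_prop) ?_
  exact (h l (Nat.lt_succ_iff.1 (Finset.mem_range.1 hl))).comp
    (f := fun z : (ℝ × ℝ) × Coord d => (z.1.2, z.2)) (by fun_prop)

theorem contDiff_hjCoef (hs : SmoothAtSection α H) (l : ℕ) :
    ContDiff ℝ ∞ (fun z : ℝ × Coord d => hjCoef α H z.1 0 l z.2) := by
  induction l using Nat.strong_induction_on with
  | _ l ih =>
    cases l with
    | zero => exact contDiff_const (c := (0 : ℝ))
    | succ l =>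
      let S : (ℝ × ℝ) × Coord d → ℝ := fun z => hjTrunc α H z.1.2 0 l z.1.1 z.2
      have hS : ContDiff ℝ ∞ S := contDiff_uncurry_hjTrunc_of_hjCoef fun k hk => ih k (by omega)
      have hrhs : SmoothAtZero fun w : ℝ × (ℝ × Coord d) =>
          H (α w.2.1 w.2.2 (spatialDifferential S ((w.1, w.2.1), w.2.2))) + 0 := fun ⟨ε, x⟩ =>
        ((hs.comp_spatialDifferential (e := Prod.snd) contDiffAt_snd hS.contDiffAt
          (spatialDifferential_eq_zero (fun x => hjTrunc_zero_right ε 0 l x) x)).comp (0, ε, x)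
            (f := fun w : ℝ × (ℝ × Coord d) => ((w.1, w.2.1), w.2.2)) (by fun_prop)).add
          contDiffAt_const
      exact contDiff_jet hrhs l

theorem contDiff_hjTrunc (hs : SmoothAtSection α H) (m : ℕ) :
    ContDiff ℝ ∞ (fun z : (ℝ × ℝ) × Coord d => hjTrunc α H z.1.2 0 m z.1.1 z.2) :=
  contDiff_uncurry_hjTrunc_of_hjCoef fun l _ => contDiff_hjCoef hs l

theorem smoothAtZero_hjTrunc_zero (hs : SmoothAtSection α H) (ε : ℝ) (m : ℕ) :
    SmoothAtZero (uncurry (hjTrunc α H ε 0 m)) := fun _ =>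
  ((contDiff_hjTrunc hs m).comp (f := fun z : ℝ × Coord d => ((z.1, ε), z.2))
    (by fun_prop)).contDiffAt

/- The function `c` enters only through multiples of powers of `h`, which have no differential. -/
theorem exists_hjTrunc_eq_add (hs : SmoothAtSection α H) (ε : ℝ) {c : ℝ → ℝ}
    (hc : ContDiff ℝ ∞ c) (m : ℕ) :
    ∃ κ : ℝ → ℝ, ContDiff ℝ ∞ κ ∧ ∀ h x, hjTrunc α H ε c m h x = hjTrunc α H ε 0 m h x + κ h := by
  induction m with
  | zero => exact ⟨0, contDiff_const, fun h x => by simp [hjTrunc]⟩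
  | succ m ih =>
    obtain ⟨κ, hκ, e⟩ := ih
    refine ⟨fun h => κ h + h ^ (m + 1) / ((m + 1).factorial : ℝ) * iteratedDeriv m c 0,
      hκ.add (by fun_prop), fun h x => ?_⟩
    have rhs_eq : alongGraph (sourcePullback α H ε) (uncurry (hjTrunc α H ε c m)) =
        alongGraph (sourcePullback α H ε) (uncurry (hjTrunc α H ε 0 m)) := by
      funext z
      simp only [alongGraph, spatialDifferential, uncurry, e, differential_add_const]
    have coef_eq : hjCoef α H ε c (m + 1) x =
        hjCoef α H ε 0 (m + 1) x + iteratedDeriv m c 0 := by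
      simp only [hjCoef, rhs_eq, Pi.zero_apply, add_zero]
      exact jet_alongGraph_add (hs.sourcePullback ε) (smoothAtZero_hjTrunc_zero hs ε m)
        (fun y => hjTrunc_zero_right ε 0 m y) hc m x
    have step : ∀ c, hjTrunc α H ε c (m + 1) h x = hjTrunc α H ε c m h x +
        h ^ (m + 1) / ((m + 1).factorial : ℝ) * hjCoef α H ε c (m + 1) x := fun _ => rfl
    rw [step, step, coef_eq, e]
    ring

theorem differential_hjTrunc (hs : SmoothAtSection α H) (ε : ℝ) {c : ℝ → ℝ}
    (hc : ContDiff ℝ ∞ c) (m : ℕ) (h : ℝ) (x : Coord d) :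
    differential (hjTrunc α H ε c m h) x = differential (hjTrunc α H ε 0 m h) x := by
  obtain ⟨κ, -, e⟩ := exists_hjTrunc_eq_add hs ε hc m
  rw [show hjTrunc α H ε c m h = fun y => hjTrunc α H ε 0 m h y + κ h from funext (e h)]
  exact differential_add_const _ _ _

theorem smoothAtZero_hjTrunc (hs : SmoothAtSection α H) (ε : ℝ) {c : ℝ → ℝ}
    (hc : ContDiff ℝ ∞ c) (m : ℕ) : SmoothAtZero (uncurry (hjTrunc α H ε c m)) := fun x => by
  obtain ⟨κ, hκ, e⟩ := exists_hjTrunc_eq_add hs ε hc m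
  refine ((smoothAtZero_hjTrunc_zero hs ε m x).add
    (hκ.contDiffAt.comp (0, x) contDiffAt_fst)).congr_of_eventuallyEq ?_
  exact .of_forall fun z => e z.1 z.2

theorem hjCoef_succ (hs : SmoothAtSection α H) (ε : ℝ) {c : ℝ → ℝ} (hc : ContDiff ℝ ∞ c) (l : ℕ)
    (x : Coord d) : hjCoef α H ε c (l + 1) x =
      jet l (alongGraph (sourcePullback α H ε) (uncurry (hjTrunc α H ε c l))) x +
        iteratedDeriv l c 0 :=
  jet_alongGraph_add (hs.sourcePullback ε) (smoothAtZero_hjTrunc hs ε hc l)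
    (fun y => hjTrunc_zero_right ε c l y) hc l x

namespace IsHJSolution

variable {ε : ℝ} {c : ℝ → ℝ} {U : Set (ℝ × Coord d × Coord d)} {N : Set (ℝ × Coord d)}
  {S : ℝ → Coord d → ℝ}

theorem smoothAtZero (hS : IsHJSolution U α H ε c N S) : SmoothAtZero (uncurry S) := fun x =>
  hS.smooth.contDiffAt (hS.isOpen.mem_nhds (hS.zero_mem x))

theorem jet_succ (hs : SmoothAtSection α H) (hc : ContDiff ℝ ∞ c)
    (hS : IsHJSolution U α H ε c N S) (l : ℕ) (x : Coord d) :
    jet (l + 1) (uncurry S) x =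
      jet l (alongGraph (sourcePullback α H ε) (uncurry S)) x + iteratedDeriv l c 0 := by
  rw [← jet_alongGraph_add (hs.sourcePullback ε) hS.smoothAtZero hS.initial hc]
  unfold jet
  rw [iteratedDeriv_succ']
  apply Filter.EventuallyEq.iteratedDeriv_eq
  filter_upwards [eventually_slice (hS.isOpen.eventually_mem (hS.zero_mem x))] with t ht
  exact (hS.equation t x ht).deriv

theorem jet_eq_hjCoef (hs : SmoothAtSection α H) (hc : ContDiff ℝ ∞ c)
    (hS : IsHJSolution U α H ε c N S) (l : ℕ) : jet l (uncurry S) = hjCoef α H ε c l := by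
  induction l using Nat.strong_induction_on with
  | _ l ih =>
    cases l with
    | zero =>
      rw [jet_zero]
      exact funext hS.initial
    | succ l =>
      have rhs_eq := jet_alongGraph_congr (hs.sourcePullback ε) hS.smoothAtZero
        (smoothAtZero_hjTrunc hs ε hc l) hS.initial (m := l) fun j hj =>
          (ih j (by omega)).trans (jet_hjTrunc ε c hj).symm
      funext x
      rw [hS.jet_succ hs hc, hjCoef_succ hs ε hc, rhs_eq]

theorem hjTrunc_eq_taylor (hs : SmoothAtSection α H) (hc : ContDiff ℝ ∞ c)
    (hS : IsHJSolution U α H ε c N S) (m : ℕ) (h : ℝ) (x : Coord d) :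
    hjTrunc α H ε c m h x = ∑ l ∈ Finset.range (m + 1),
      h ^ l / (l.factorial : ℝ) * iteratedDeriv l (fun t => S t x) 0 := by
  simp_rw [hjTrunc_eq_sum, ← hS.jet_eq_hjCoef hs hc]
  rfl

end IsHJSolution

end HamiltonJacobi

/-! ### Oddness of the generating function -/

section Oddness

open Function

variable {d : ℕ}

/-- The canonical Poisson bracket on `T*ℝ^d`. -/
noncomputable def canonicalBracket (a b : Coord d × Coord d → ℝ) (z : Coord d × Coord d) : ℝ :=
  ∑ k, (dirDeriv (Pi.single k 1, 0) a z * dirDeriv (0, Pi.single k 1) b z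
    - dirDeriv (0, Pi.single k 1) a z * dirDeriv (Pi.single k 1, 0) b z)

/-- The antisymplectic involution `(x, p) ↦ (x, -p)`, which intertwines `α_ε` and `β_ε`. -/
def reflect (z : Coord d × Coord d) : Coord d × Coord d := (z.1, -z.2)

theorem contDiff_reflect : ContDiff ℝ ∞ (reflect : Coord d × Coord d → Coord d × Coord d) :=
  contDiff_fst.prodMk contDiff_snd.neg

theorem differentiableAt_alongGraph {a : Coord d × Coord d → ℝ} {S : ℝ × Coord d → ℝ}
    {z : ℝ × Coord d} (ha : DifferentiableAt ℝ a (z.2, spatialDifferential S z))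
    (hS : ContDiffAt ℝ 2 S z) : DifferentiableAt ℝ (alongGraph a S) z :=
  DifferentiableAt.comp z (f := fun z => (z.2, spatialDifferential S z)) ha
    (differentiableAt_snd.prodMk
      ((contDiffAt_spatialDifferential (m := 1) hS (by norm_num)).differentiableAt (by simp)))

theorem dirDeriv_alongGraph {a : Coord d × Coord d → ℝ} {S : ℝ × Coord d → ℝ} {z : ℝ × Coord d}
    (ha : DifferentiableAt ℝ a (z.2, spatialDifferential S z)) (hS : ContDiffAt ℝ 2 S z)
    (w : ℝ × Coord d) :
    dirDeriv w (alongGraph a S) z = dirDeriv (w.2, 0) a (z.2, spatialDifferential S z) +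
      ∑ l, dirDeriv (0, Pi.single l 1) a (z.2, spatialDifferential S z) *
        dirDeriv w (dirDeriv (0, Pi.single l 1) S) z := by
  set σ := spatialDifferential S
  have hσd : DifferentiableAt ℝ σ z :=
    (contDiffAt_spatialDifferential (m := 1) hS (by norm_num)).differentiableAt (by simp)
  have chain : dirDeriv w (alongGraph a S) z = fderiv ℝ a (z.2, σ z) (w.2, fderiv ℝ σ z w) := by
    have h_graph : HasFDerivAt (fun z : ℝ × Coord d => (z.2, σ z))
        ((ContinuousLinearMap.snd ℝ ℝ (Coord d)).prod (fderiv ℝ σ z)) z :=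
      hasFDerivAt_snd.prodMk hσd.hasFDerivAt
    exact congrArg (fun L : ℝ × Coord d →L[ℝ] ℝ => L w) (ha.hasFDerivAt.comp z h_graph).fderiv
  have component : ∀ l, fderiv ℝ σ z w l = dirDeriv w (dirDeriv (0, Pi.single l 1) S) z := by
    intro l
    have h_slice : (fun y => σ y l) =ᶠ[𝓝 z] dirDeriv (0, Pi.single l 1) S := by
      filter_upwards [eventually_differentiableAt hS (by norm_num)] with y hy
      exact spatialDifferential_apply hy l
    have h_fderiv := ((hasFDerivAt_pi'.1 hσd.hasFDerivAt l).congr_of_eventuallyEq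
      h_slice.symm).fderiv
    exact congrArg (fun L : ℝ × Coord d →L[ℝ] ℝ => L w) h_fderiv.symm
  have decomposition : (w.2, fderiv ℝ σ z w) =
      (w.2, 0) + ∑ l, fderiv ℝ σ z w l • ((0 : Coord d), (Pi.single l 1 : Coord d)) := by
    refine Prod.ext (by simp [Prod.fst_sum]) ?_
    simpa [Prod.snd_sum] using pi_eq_sum_univ' (fderiv ℝ σ z w)
  rw [chain, decomposition, map_add, map_sum]
  simp only [map_smul, smul_eq_mul, component, mul_comm]
  rfl

theorem transport_identity {ι : Type*} [Fintype ι] (ax ap bx bp T : ι → ℝ) (h : ι → ι → ℝ)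
    (hsymm : ∀ k l, h k l = h l k) (hbr : ∑ k, (ax k * bp k - ap k * bx k) = 0) :
    ∑ k, (ap k - bp k) * T k =
      ∑ k, ap k * (ax k + ∑ l, ap l * h k l - (bx k + ∑ l, bp l * h k l)) +
      ∑ k, (ap k - bp k) * (T k - (ax k + ∑ l, ap l * h k l)) := by
  have hessian_symm : ∑ k, bp k * ∑ l, ap l * h k l = ∑ k, ap k * ∑ l, bp l * h k l := by
    simp_rw [Finset.mul_sum]
    rw [Finset.sum_comm]
    refine Finset.sum_congr rfl fun k _ => Finset.sum_congr rfl fun l _ => ?_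
    rw [hsymm l k]; ring
  rw [← sub_eq_zero, ← Finset.sum_add_distrib, ← Finset.sum_sub_distrib]
  calc _ = ∑ k, (-(ax k * bp k - ap k * bx k)
        + (ap k * (∑ l, bp l * h k l) - bp k * ∑ l, ap l * h k l)) :=
        Finset.sum_congr rfl fun k _ => by ring
    _ = 0 := by
      rw [Finset.sum_add_distrib, Finset.sum_neg_distrib, hbr, Finset.sum_sub_distrib,
        hessian_symm]
      simp

/- If `∂_t S = a` held exactly along the graph, this would say that `a - b` is transported along
the projection to `M` of the Hamiltonian flow of `a`; the second sum is the defect. -/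
theorem dirDeriv_sub_alongGraph {a b : Coord d × Coord d → ℝ} {S : ℝ × Coord d → ℝ}
    {z : ℝ × Coord d} (ha : DifferentiableAt ℝ a (z.2, spatialDifferential S z))
    (hb : DifferentiableAt ℝ b (z.2, spatialDifferential S z)) (hS : ContDiffAt ℝ 2 S z)
    (hbr : canonicalBracket a b (z.2, spatialDifferential S z) = 0) :
    dirDeriv (1, 0) (fun z => alongGraph a S z - alongGraph b S z) z =
      ∑ k, alongGraph (dirDeriv (0, Pi.single k 1) a) S z *
        dirDeriv (0, Pi.single k 1) (fun z => alongGraph a S z - alongGraph b S z) z +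
      ∑ k, (alongGraph (dirDeriv (0, Pi.single k 1) a) S z -
          alongGraph (dirDeriv (0, Pi.single k 1) b) S z) *
        dirDeriv (0, Pi.single k 1) (fun z => dirDeriv (1, 0) S z - alongGraph a S z) z := by
  have dirDeriv_sub : ∀ {f g : ℝ × Coord d → ℝ}, DifferentiableAt ℝ f z → DifferentiableAt ℝ g z →
      ∀ w, dirDeriv w (fun z => f z - g z) z = dirDeriv w f z - dirDeriv w g z :=
    fun hf hg w => congrArg (fun L : ℝ × Coord d →L[ℝ] ℝ => L w) (fderiv_fun_sub hf hg)
  have hA := differentiableAt_alongGraph ha hS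
  have hB := differentiableAt_alongGraph hb hS
  have hT : DifferentiableAt ℝ (dirDeriv (1, 0) S) z :=
    (contDiffAt_dirDeriv (m := 1) hS (by norm_num) _).differentiableAt (by simp)
  have dirDeriv_zero : ∀ g : Coord d × Coord d → ℝ, ∀ y, dirDeriv ((0 : Coord d), 0) g y = 0 :=
    fun g y => map_zero (fderiv ℝ g y)
  simp only [dirDeriv_sub hA hB, dirDeriv_sub hT hA, dirDeriv_alongGraph ha hS,
    dirDeriv_alongGraph hb hS, dirDeriv_zero, zero_add, ← Finset.sum_sub_distrib, ← sub_mul,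
    dirDeriv_comm hS _ (1, 0)]
  exact transport_identity _ _ _ _ _
    (fun k l => dirDeriv (0, Pi.single k 1) (dirDeriv (0, Pi.single l 1) S) z)
    (fun k l => dirDeriv_comm hS _ _) hbr

theorem jet_eq_zero_of_transport {X ι : Type*} [NormedAddCommGroup X] [NormedSpace ℝ X] [Fintype ι]
    {D R : ℝ × X → ℝ} {u v : ι → ℝ × X → ℝ} {e : ι → X} {m : ℕ} (hD : SmoothAtZero D)
    (hR : SmoothAtZero R) (hu : ∀ i, SmoothAtZero (u i)) (hv : ∀ i, SmoothAtZero (v i))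
    (transport : ∀ x, dirDeriv (1, 0) D =ᶠ[𝓝 (0, x)] fun z =>
      ∑ i, u i z * dirDeriv (0, e i) D z + ∑ i, v i z * dirDeriv (0, e i) R z)
    (D_zero : ∀ x, D (0, x) = 0) (jet_R : ∀ j < m, jet j R = 0) {j : ℕ} (hj : j ≤ m) :
    jet j D = 0 := by
  induction j using Nat.strong_induction_on with
  | _ j ih =>
    cases j with
    | zero => exact (jet_zero D).trans (funext D_zero)
    | succ j =>
      have hu_D : ∀ i, SmoothAtZero fun z => u i z * dirDeriv (0, e i) D z :=
        fun i => (hu i).mul (hD.dirDeriv _)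
      have hv_R : ∀ i, SmoothAtZero fun z => v i z * dirDeriv (0, e i) R z :=
        fun i => (hv i).mul (hR.dirDeriv _)
      funext x
      have jet_u_D : ∀ i, jet j (fun z => u i z * dirDeriv (0, e i) D z) x = 0 := fun i =>
        jet_mul_eq_zero (hu i) (hD.dirDeriv _) fun k hk => by
          rw [← fderiv_jet hD, ih k (by omega) (by omega)]
          simp
      have jet_v_R : ∀ i, jet j (fun z => v i z * dirDeriv (0, e i) R z) x = 0 := fun i =>
        jet_mul_eq_zero (hv i) (hR.dirDeriv _) fun k hk => by
          rw [← fderiv_jet hR, jet_R k (by omega)]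
          simp
      rw [jet_succ hD, jet_congr (transport x), jet_add (.sum hu_D) (.sum hv_R), jet_sum hu_D,
        jet_sum hv_R]
      simp [jet_u_D, jet_v_R]

theorem jet_alongGraph_eq_of_canonicalBracket_eq_zero {a b : Coord d × Coord d → ℝ}
    {S : ℝ × Coord d → ℝ} {m : ℕ} (ha : ∀ x, ContDiffAt ℝ ∞ a (x, 0))
    (hb : ∀ x, ContDiffAt ℝ ∞ b (x, 0)) (hab : ∀ x, a (x, 0) = b (x, 0))
    (hbr : ∀ x, ∀ᶠ z in 𝓝 (x, 0), canonicalBracket a b z = 0)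
    (hS : SmoothAtZero S) (h0 : ∀ x, S (0, x) = 0)
    (hHJ : ∀ j < m, jet (j + 1) S = jet j (alongGraph a S)) {j : ℕ} (hj : j ≤ m) :
    jet j (alongGraph a S) = jet j (alongGraph b S) := by
  have hA := hS.alongGraph ha h0
  have hB := hS.alongGraph hb h0
  have hap : ∀ k : Fin d, SmoothAtZero (alongGraph (dirDeriv (0, Pi.single k 1) a) S) := fun k =>
    hS.alongGraph (fun x => contDiffAt_dirDeriv (ha x) (by simp) _) h0
  have hbp : ∀ k : Fin d, SmoothAtZero (alongGraph (dirDeriv (0, Pi.single k 1) b) S) := fun k =>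
    hS.alongGraph (fun x => contDiffAt_dirDeriv (hb x) (by simp) _) h0
  have tendsto_graph : ∀ x, Tendsto (fun z : ℝ × Coord d => (z.2, spatialDifferential S z))
      (𝓝 (0, x)) (𝓝 (x, 0)) := fun x => by
    have := (continuousAt_snd (p := ((0 : ℝ), x))).prodMk (hS.spatialDifferential x).continuousAt
    simpa only [ContinuousAt, spatialDifferential_eq_zero h0] using this
  have jet_sub_zero := jet_eq_zero_of_transport (e := fun k => Pi.single k 1)
    (hA.sub hB) ((hS.dirDeriv (1, 0)).sub hA) hap (fun k => (hap k).sub (hbp k))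
    (fun x => ?_) (fun x => ?_) (fun i hi => ?_) hj
  · funext x
    exact sub_eq_zero.1 ((jet_sub hA hB j x).symm.trans (congrFun jet_sub_zero x))
  · have hS2 : ContDiffAt ℝ 2 S (0, x) := (hS x).of_le (by norm_cast)
    filter_upwards [(tendsto_graph x).eventually (eventually_differentiableAt (ha x) (by simp)),
      (tendsto_graph x).eventually (eventually_differentiableAt (hb x) (by simp)),
      (tendsto_graph x).eventually (hbr x), hS2.eventually (by simp)] with z hza hzb hzbr hzS
    exact dirDeriv_sub_alongGraph hza hzb hzS hzbr
  · simp only [alongGraph, spatialDifferential_eq_zero h0, hab, sub_self]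
  · funext x
    rw [jet_sub (hS.dirDeriv _) hA, ← jet_succ hS, hHJ i hi, sub_self, Pi.zero_apply]

variable {α : ℝ → Coord d → Coord d → Coord d} {H : Coord d → ℝ}

theorem hjTrunc_neg {ε : ℝ} {c : ℝ → ℝ} {m : ℕ}
    (even : ∀ l ≤ m, Even l → hjCoef α H ε c l = 0) (h : ℝ) :
    hjTrunc α H ε c m (-h) = -hjTrunc α H ε c m h := by
  funext x
  simp only [Pi.neg_apply, hjTrunc_eq_sum, ← Finset.sum_neg_distrib]
  refine Finset.sum_congr rfl fun l hl => ?_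
  rcases Nat.even_or_odd l with hl_even | hl_odd
  · simp [even l (Nat.lt_succ_iff.1 (Finset.mem_range.1 hl)) hl_even]
  · rw [hl_odd.neg_pow]; ring

theorem hjCoef_succ_of_le (hs : SmoothAtSection α H) (ε : ℝ) {m j : ℕ} (hj : j ≤ m) :
    hjCoef α H ε 0 (j + 1) = jet j (alongGraph (sourcePullback α H ε) (uncurry (hjTrunc α H ε 0 m)))
    := by
  rw [← jet_alongGraph_congr (hs.sourcePullback ε) (smoothAtZero_hjTrunc_zero hs ε j)
    (smoothAtZero_hjTrunc_zero hs ε m) (fun x => hjTrunc_zero_right ε 0 j x) fun i hi =>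
      (jet_hjTrunc ε 0 hi).trans (jet_hjTrunc ε 0 (hi.trans hj)).symm]
  simp only [hjCoef, Pi.zero_apply, add_zero]

/- For odd `m` the truncation `Ŝ` of order `m` is odd, so that `α_ε^* H` and `β_ε^* H` along its
graph are exchanged by `h ↦ -h`; since they agree to order `m`, their `m`-th derivative is zero. -/
theorem hjCoef_even_eq_zero (hs : SmoothAtSection α H) {ε : ℝ}
    (hbr : ∀ x, ∀ᶠ z in 𝓝 (x, 0),
      canonicalBracket (sourcePullback α H ε) (sourcePullback α H ε ∘ reflect) z = 0)
    (l : ℕ) (hl : Even l) : hjCoef α H ε 0 l = 0 := by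
  induction l using Nat.strong_induction_on with
  | _ l ih =>
    cases l with
    | zero => rfl
    | succ m =>
      have hm : Odd m := Nat.not_even_iff_odd.1 (Nat.even_add_one.1 hl)
      set a := sourcePullback α H ε
      set S := uncurry (hjTrunc α H ε 0 m) with hS_def
      have ha : ∀ x, ContDiffAt ℝ ∞ a (x, 0) := hs.sourcePullback ε
      have hb : ∀ x, ContDiffAt ℝ ∞ (a ∘ reflect) (x, 0) := fun x =>
        ContDiffAt.comp (x, (0 : Coord d)) (by simpa [reflect] using ha x)
          contDiff_reflect.contDiffAt
      have hab := jet_alongGraph_eq_of_canonicalBracket_eq_zero (m := m) (S := S) ha hb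
        (fun x => by simp [reflect]) hbr (smoothAtZero_hjTrunc_zero hs ε m)
        (fun x => hjTrunc_zero_right ε 0 m x)
        (fun j hj => by rw [← hjCoef_succ_of_le hs ε hj.le, hS_def, jet_hjTrunc ε 0 hj]) le_rfl
      have time_reversal : ∀ t x, alongGraph (a ∘ reflect) S (t, x) = alongGraph a S (-t, x) := by
        intro t x
        have S_neg : hjTrunc α H ε 0 m (-t) = -hjTrunc α H ε 0 m t :=
          hjTrunc_neg (fun k hk => ih k (by omega)) t
        change a (x, -differential (hjTrunc α H ε 0 m t) x) =
          a (x, differential (hjTrunc α H ε 0 m (-t)) x)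
        rw [S_neg, differential_neg]
      rw [hjCoef_succ_of_le hs ε le_rfl]
      funext x
      have parity := jet_of_comp_neg time_reversal m x
      rw [← hab, hm.neg_one_pow, neg_one_smul] at parity
      exact self_eq_neg.1 parity

theorem differential_hjTrunc_neg (hs : SmoothAtSection α H) {ε : ℝ}
    (hbr : ∀ x, ∀ᶠ z in 𝓝 (x, 0),
      canonicalBracket (sourcePullback α H ε) (sourcePullback α H ε ∘ reflect) z = 0)
    {c : ℝ → ℝ} (hc : ContDiff ℝ ∞ c) (m : ℕ) (h : ℝ) (x : Coord d) :
    differential (hjTrunc α H ε c m (-h)) x = -differential (hjTrunc α H ε c m h) x := by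
  rw [differential_hjTrunc hs ε hc, differential_hjTrunc hs ε hc,
    hjTrunc_neg fun l _ => hjCoef_even_eq_zero hs hbr l, differential_neg]

end Oddness

/-! ### Composition operators on spaces of continuous maps -/

section PostComposition

universe u

variable {K : Type*} [TopologicalSpace K] [CompactSpace K]
  {E F : Type u} [NormedAddCommGroup E] [NormedSpace ℝ E] [NormedAddCommGroup F] [NormedSpace ℝ F]

/-- Pointwise application `(A, h) ↦ (t ↦ A(t) h(t))` of continuous families of operators, as a
bounded bilinear map. It describes the derivative of `u ↦ g ∘ u`. -/
noncomputable def pointwiseApply : C(K, E →L[ℝ] F) →L[ℝ] C(K, E) →L[ℝ] C(K, F) :=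
  LinearMap.mkContinuous₂
    (LinearMap.mk₂ ℝ
      (fun (A : C(K, E →L[ℝ] F)) (h : C(K, E)) => (⟨fun t => A t (h t), by fun_prop⟩ : C(K, F)))
      (fun A B h => by ext t; simp) (fun r A h => by ext t; simp)
      (fun A h k => by ext t; simp) (fun r A h => by ext t; simp))
    1 (fun A h => by
      rw [ContinuousMap.norm_le _ (by positivity), one_mul]
      intro t
      exact (A t).le_of_opNorm_le_of_le (A.norm_coe_le_norm t) (h.norm_coe_le_norm t))

theorem hasFDerivAt_postcomp {g : C(E, F)} {g' : C(E, E →L[ℝ] F)}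
    (hg : ∀ x, HasFDerivAt g (g' x) x) (u : C(K, E)) :
    HasFDerivAt (fun u : C(K, E) => g.comp u) (pointwiseApply (g'.comp u)) u := by
  rw [hasFDerivAt_iff_isLittleO_nhds_zero, Asymptotics.isLittleO_iff]
  intro c hc
  have range_compact : IsCompact (Set.range u) := isCompact_range u.continuous
  have g'_uniform := range_compact.uniformContinuousAt_of_continuousAt g'
    (fun a _ => g'.continuous.continuousAt) (Metric.dist_mem_uniformity hc)
  obtain ⟨δ, hδ, near_range⟩ := Metric.mem_uniformity_dist.1 g'_uniform
  filter_upwards [Metric.ball_mem_nhds (0 : C(K, E)) hδ] with h hh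
  rw [mem_ball_zero_iff] at hh
  refine (ContinuousMap.norm_le _ (by positivity)).2 fun t => ?_
  have h_le : ‖h t‖ ≤ ‖h‖ := h.norm_coe_le_norm t
  have g'_near : ∀ x ∈ Metric.ball (u t) δ, ‖g' x - g' (u t)‖ ≤ c := fun x hx => by
    rw [← dist_eq_norm, dist_comm]
    exact (near_range (Metric.mem_ball'.1 hx) ⟨t, rfl⟩).le
  have mean_value := (convex_ball (u t) δ).norm_image_sub_le_of_norm_hasFDerivWithin_le'
    (fun x _ => (hg x).hasFDerivWithinAt) g'_near (Metric.mem_ball_self hδ)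
    (y := u t + h t) (by simpa using h_le.trans_lt hh)
  rw [add_sub_cancel_left] at mean_value
  exact mean_value.trans (by gcongr)

theorem contDiff_nat_postcomp (n : ℕ) {g : C(E, F)} (hg : ContDiff ℝ n g) :
    ContDiff ℝ n (fun u : C(K, E) => g.comp u) := by
  induction n generalizing F with
  | zero => simpa using! g.continuous_postcomp
  | succ n ih =>
    rw [Nat.cast_succ, contDiff_succ_iff_hasFDerivAt] at hg ⊢
    obtain ⟨g', g'_contDiff, hg'⟩ := hg
    let G : C(E, E →L[ℝ] F) := ⟨g', g'_contDiff.continuous⟩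
    have apply_contDiff : ContDiff ℝ n fun A : C(K, E →L[ℝ] F) => pointwiseApply A :=
      ContinuousLinearMap.contDiff _
    exact ⟨fun u => pointwiseApply (G.comp u),
      apply_contDiff.comp (ih (g := G) g'_contDiff), hasFDerivAt_postcomp (g' := G) hg'⟩

theorem contDiff_postcomp {g : C(E, F)} (hg : ContDiff ℝ ∞ g) :
    ContDiff ℝ ∞ (fun u : C(K, E) => g.comp u) :=
  contDiff_infty.2 fun n => contDiff_nat_postcomp n (contDiff_infty.1 hg n)

end PostComposition

/-! ### Implicit functions along a set -/

section ImplicitFunction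

variable {V X Z : Type*} [NormedAddCommGroup V] [NormedSpace ℝ V] [CompleteSpace V]
  [NormedAddCommGroup X] [NormedSpace ℝ X] [CompleteSpace X]
  [NormedAddCommGroup Z] [NormedSpace ℝ Z] [CompleteSpace Z] {F : V × X → Z} {n : ℕ∞ω}

theorem contDiffAt_of_implicit {ψ : V → X} {v : V} (hF : ContDiffAt ℝ n F (v, ψ v)) (hn : n ≠ 0)
    (hinv : (fderiv ℝ F (v, ψ v) ∘L .inr ℝ V X).IsInvertible) (hψ : ContinuousAt ψ v)
    (h : ∀ᶠ v' in 𝓝 v, F (v', ψ v') = F (v, ψ v)) : ContDiffAt ℝ n ψ v := by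
  refine (hF.contDiffAt_implicitFunction hn hinv).congr_of_eventuallyEq ?_
  have unique_near_graph := (continuousAt_id.prodMk hψ).eventually
    (hF.eventually_apply_eq_iff_implicitFunction hn hinv)
  filter_upwards [h, unique_near_graph] with v' hv' hunique
  exact (hunique.1 hv').symm

theorem exists_local_implicitFunction (hF : ContDiff ℝ n F) (hn : n ≠ 0) {s : V}
    (h0 : F (s, 0) = 0) (hinv : (fderiv ℝ F (s, 0) ∘L .inr ℝ V X).IsInvertible) :
    ∃ r > 0, ∃ N, IsOpen N ∧ s ∈ N ∧ ∃ ψ : V → X, ContDiffOn ℝ n ψ N ∧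
      ∀ v ∈ N, ‖ψ v‖ < r ∧ ∀ y, ‖y‖ < r → (F (v, y) = 0 ↔ ψ v = y) := by
  have hF1 : ContDiffAt ℝ 1 F (s, 0) := hF.contDiffAt.of_le (ENat.one_le_iff_ne_zero_withTop.2 hn)
  set ψ := hF1.implicitFunction one_ne_zero hinv
  have ψ_contDiffAt : ContDiffAt ℝ 1 ψ s := hF1.contDiffAt_implicitFunction one_ne_zero hinv
  have ψ_s : ψ s = 0 := hF1.implicitFunction_apply_self one_ne_zero hinv
  have unique : ∀ᶠ z in 𝓝 (s, (0 : X)), F z = F (s, 0) ↔ ψ z.1 = z.2 :=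
    hF1.eventually_apply_eq_iff_implicitFunction one_ne_zero hinv
  have graph_tendsto : Tendsto (fun v => (v, ψ v)) (𝓝 s) (𝓝 (s, 0)) := by
    rw [← ψ_s]
    exact continuousAt_id.prodMk ψ_contDiffAt.continuousAt
  have invertible : ∀ᶠ z in 𝓝 (s, (0 : X)), (fderiv ℝ F z ∘L .inr ℝ V X).IsInvertible :=
    ((hF.continuous_fderiv hn).clm_comp_const _).continuousAt.eventually
      (ContinuousLinearEquiv.isOpen.eventually_mem hinv)
  have norm_tendsto : Tendsto (fun v => ‖ψ v‖) (𝓝 s) (𝓝 0) := by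
    simpa [ψ_s] using ψ_contDiffAt.continuousAt.norm.tendsto
  rw [nhds_prod_eq] at unique
  obtain ⟨N₁, hN₁, B, hB, unique_on⟩ := eventually_prod_iff.1 unique
  obtain ⟨r, hr, ball_subset⟩ := Metric.eventually_nhds_iff_ball.1 hB
  have near_s := hN₁.and ((norm_tendsto.eventually_lt_const hr).and
    ((graph_tendsto.eventually invertible).and (ψ_contDiffAt.eventually (by simp))))
  obtain ⟨N, hN, N_open, s_mem⟩ := eventually_nhds_iff.1 near_s
  have solves : ∀ v ∈ N, ∀ y, ‖y‖ < r → (F (v, y) = 0 ↔ ψ v = y) := fun v hv y hy => by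
    rw [← h0]
    exact unique_on (hN v hv).1 (ball_subset y (mem_ball_zero_iff.2 hy))
  refine ⟨r, hr, N, N_open, s_mem, ψ, fun v hv => ?_, fun v hv => ⟨(hN v hv).2.1, solves v hv⟩⟩
  have F_eq_zero : ∀ v ∈ N, F (v, ψ v) = 0 := fun v hv =>
    (solves v hv _ (hN v hv).2.1).2 rfl
  obtain ⟨-, -, v_invertible, ψ_smooth⟩ := hN v hv
  refine (contDiffAt_of_implicit hF.contDiffAt hn v_invertible ψ_smooth.continuousAt
    ?_).contDiffWithinAt
  filter_upwards [N_open.mem_nhds hv] with v' hv'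
  rw [F_eq_zero v hv, F_eq_zero v' hv']

theorem exists_implicitFunction_along (hF : ContDiff ℝ n F) (hn : n ≠ 0) {S : Set V}
    (h0 : ∀ s ∈ S, F (s, 0) = 0)
    (hinv : ∀ s ∈ S, (fderiv ℝ F (s, 0) ∘L .inr ℝ V X).IsInvertible) :
    ∃ O, IsOpen O ∧ S ⊆ O ∧ ∃ ψ : V → X, ContDiffOn ℝ n ψ O ∧ (∀ v ∈ O, F (v, ψ v) = 0) ∧
      ∀ s ∈ S, ∀ᶠ z in 𝓝 (s, 0), F z = 0 → ψ z.1 = z.2 := by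
  have local_solution := fun s : S => exists_local_implicitFunction hF hn (h0 s s.2) (hinv s s.2)
  choose r hr N hN mem_N φ φ_smooth φ_spec using local_solution
  have φ_le : ∀ s t v, v ∈ N s → v ∈ N t → r s ≤ r t → φ s v = φ t v := by
    intro s t v hs ht hle
    have φ_s_solves := (φ_spec s v hs).2 _ (φ_spec s v hs).1
    exact (((φ_spec t v ht).2 _ ((φ_spec s v hs).1.trans_le hle)).1 (φ_s_solves.2 rfl)).symm
  have φ_agree : ∀ s t v, v ∈ N s → v ∈ N t → φ s v = φ t v := fun s t v hs ht =>
    (le_total (r s) (r t)).elim (φ_le s t v hs ht) fun h => (φ_le t s v ht hs h).symm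
  classical
  let ψ : V → X := fun v => if h : ∃ s, v ∈ N s then φ h.choose v else 0
  have ψ_eq : ∀ s, ∀ v ∈ N s, ψ v = φ s v := fun s v hv => by
    have hex : ∃ s, v ∈ N s := ⟨s, hv⟩
    exact (dif_pos hex).trans (φ_agree _ s v hex.choose_spec hv)
  refine ⟨⋃ s, N s, isOpen_iUnion hN, fun s hs => Set.mem_iUnion.2 ⟨⟨s, hs⟩, mem_N ⟨s, hs⟩⟩, ψ,
    fun v hv => ?_, fun v hv => ?_, fun s hs => ?_⟩
  · obtain ⟨s, hs⟩ := Set.mem_iUnion.1 hv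
    refine (((φ_smooth s).contDiffAt ((hN s).mem_nhds hs)).congr_of_eventuallyEq
      ?_).contDiffWithinAt
    filter_upwards [(hN s).mem_nhds hs] using ψ_eq s
  · obtain ⟨s, hs⟩ := Set.mem_iUnion.1 hv
    rw [ψ_eq s v hs]
    exact ((φ_spec s v hs).2 _ (φ_spec s v hs).1).2 rfl
  · lift s to S using hs
    have near_s := ((hN s).eventually_mem (mem_N s)).prod_nhds
      (Metric.ball_mem_nhds (0 : X) (hr s))
    filter_upwards [near_s] with z hz hFz
    rw [ψ_eq s _ hz.1]
    exact ((φ_spec s _ hz.1).2 _ (mem_ball_zero_iff.1 hz.2)).1 hFz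

end ImplicitFunction

/-! ### Orbits with prescribed mean -/

section Paths

open unitInterval

variable {E : Type*} [NormedAddCommGroup E]

/-- The extension of a path on `[0, 1]` to the real line, constant outside `[0, 1]`. -/
noncomputable def pathExt (u : C(I, E)) : C(ℝ, E) := u.IccExtend zero_le_one

theorem pathExt_coe (u : C(I, E)) (t : I) : pathExt u t = u t := Set.IccExtend_val _ _ _

theorem pathExt_zero (u : C(I, E)) : pathExt u 0 = u 0 := pathExt_coe u 0

theorem pathExt_of_mem (u : C(I, E)) {t : ℝ} (ht : t ∈ I) : pathExt u t = u ⟨t, ht⟩ :=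
  pathExt_coe u ⟨t, ht⟩

/-- Time reversal of paths. -/
def revPath (u : C(I, E)) : C(I, E) := u.comp ⟨σ, continuous_symm⟩

theorem pathExt_revPath (u : C(I, E)) {t : ℝ} (ht : t ∈ I) :
    pathExt (revPath u) t = pathExt u (1 - t) := by
  rw [pathExt_of_mem _ ht, pathExt_of_mem _ (Set.Icc.mem_iff_one_sub_mem.1 ht)]
  rfl

variable [NormedSpace ℝ E]

theorem tendsto_smul_snd_nhds_zero (r : ℝ) (x : E) :
    Tendsto (fun v : E × E => (v.1, r • v.2)) (𝓝 (x, 0)) (𝓝 (x, 0)) := by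
  have smul_continuous : Continuous fun v : E × E => (v.1, r • v.2) := by fun_prop
  simpa using smul_continuous.tendsto (x, 0)

theorem tendsto_neg_snd_nhds_zero (x : E) :
    Tendsto (fun v : E × E => (v.1, -v.2)) (𝓝 (x, 0)) (𝓝 (x, 0)) := by
  simpa only [neg_one_smul] using tendsto_smul_snd_nhds_zero (-1) x

theorem norm_integral_pathExt_le (u : C(I, E)) (t : I) :
    ‖∫ s in (0 : ℝ)..t, pathExt u s‖ ≤ ‖u‖ := by
  refine (intervalIntegral.norm_integral_le_of_norm_le_const
    fun s _ => u.norm_coe_le_norm (Set.projIcc 0 1 zero_le_one s)).trans ?_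
  rw [sub_zero, abs_of_nonneg t.2.1]
  exact mul_le_of_le_one_right (norm_nonneg u) t.2.2

/-- The primitive of a path which vanishes at `0`. -/
noncomputable def primitive : C(I, E) →L[ℝ] C(I, E) :=
  LinearMap.mkContinuous
    { toFun := fun u => ⟨fun t => ∫ s in (0 : ℝ)..t, pathExt u s,
        (intervalIntegral.continuous_primitive
          (fun a b => (pathExt u).continuous.intervalIntegrable a b) 0).comp
            continuous_subtype_val⟩
      map_add' := fun u v => by
        ext t
        exact intervalIntegral.integral_add ((pathExt u).continuous.intervalIntegrable _ _)
          ((pathExt v).continuous.intervalIntegrable _ _)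
      map_smul' := fun r u => by
        ext t
        exact intervalIntegral.integral_smul r _ }
    1 fun u => by
      rw [ContinuousMap.norm_le _ (by positivity), one_mul]
      exact norm_integral_pathExt_le u

theorem primitive_apply (u : C(I, E)) (t : I) :
    primitive u t = ∫ s in (0 : ℝ)..t, pathExt u s := rfl

/-- The mean of a path. -/
noncomputable def mean : C(I, E) →L[ℝ] E := (ContinuousMap.evalCLM ℝ (1 : I)).comp primitive

theorem mean_apply (u : C(I, E)) : mean u = ∫ s in (0 : ℝ)..1, pathExt u s := rfl

/-- The constant path at a point. -/
noncomputable abbrev constPath : E →L[ℝ] C(I, E) := ContinuousLinearMap.const ℝ I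

/-- The primitive of a path which has mean zero. -/
noncomputable def meanZeroPrimitive : C(I, E) →L[ℝ] C(I, E) :=
  primitive - constPath.comp (mean.comp primitive)

/-- The path `t ↦ (x + η(t), q)`, for `v = ((x, q), η)`. -/
noncomputable def deviate : (E × E) × C(I, E) →L[ℝ] C(I, E × E) :=
  constPath.comp (.fst ℝ _ _) +
    ((ContinuousLinearMap.inl ℝ E E).compLeftContinuous ℝ I).comp (.snd ℝ _ _)

theorem deviate_apply (x q : E) (η : C(I, E)) (t : I) :
    deviate ((x, q), η) t = (x + η t, q) := by
  simp [deviate]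

/-- The equation `η = ∫ w(x + η, q)`, with the primitive of mean zero, satisfied by the deviation
`η` from its mean `x` of an orbit of `w(·, q)`. -/
noncomputable def deviationDefect (w : C(E × E, E)) (z : (E × E) × C(I, E)) : C(I, E) :=
  z.2 - meanZeroPrimitive (w.comp (deviate z))

/-- The path `u` solves `u' = w(u, q)` on `[0, 1]` and has mean `x`, where `v = (x, q)`. -/
structure IsOrbitWithMean (w : E × E → E) (v : E × E) (u : C(I, E)) : Prop where
  isIntegralCurveOn : IsIntegralCurveOn (pathExt u) (fun _ y => w (y, v.2)) I
  mean_eq : mean u = v.1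

theorem deviationDefect_zero {w : C(E × E, E)} (hw : ∀ y, w (y, 0) = 0) (x : E) (η : C(I, E)) :
    deviationDefect w ((x, 0), η) = η := by
  have velocity_zero : w.comp (deviate ((x, 0), η)) = 0 := by
    ext t
    rw [ContinuousMap.comp_apply, deviate_apply, hw, ContinuousMap.zero_apply]
  rw [deviationDefect, velocity_zero, map_zero, sub_zero]

theorem contDiff_deviationDefect {w : C(E × E, E)} (hw : ContDiff ℝ ∞ w) :
    ContDiff ℝ ∞ (deviationDefect w) :=
  contDiff_snd.sub
    (meanZeroPrimitive.contDiff.comp ((contDiff_postcomp hw).comp deviate.contDiff))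

theorem mean_revPath (u : C(I, E)) : mean (revPath u) = mean u := by
  have reversed : Set.EqOn (pathExt (revPath u)) (fun s => pathExt u (1 - s)) (Set.uIcc 0 1) := by
    rw [Set.uIcc_of_le zero_le_one]
    exact fun s hs => pathExt_revPath u hs
  rw [mean_apply, intervalIntegral.integral_congr reversed,
    intervalIntegral.integral_comp_sub_left, sub_self, sub_zero, mean_apply]

theorem IsOrbitWithMean.revPath {w : E × E → E} (hw : ∀ y q, w (y, -q) = -w (y, q)) {x q : E}
    {u : C(I, E)} (hu : IsOrbitWithMean w (x, q) u) : IsOrbitWithMean w (x, -q) (revPath u) := by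
  refine ⟨fun t ht => ?_, (mean_revPath u).trans hu.mean_eq⟩
  have maps : Set.MapsTo (fun t : ℝ => 1 - t) I I := fun t => Set.Icc.mem_iff_one_sub_mem.1
  have reversed := (hu.isIntegralCurveOn (1 - t) (maps ht)).scomp t
    ((hasDerivWithinAt_id t I).const_sub 1) maps
  rw [neg_one_smul, ← hw, ← pathExt_revPath u ht] at reversed
  exact reversed.congr (fun s hs => pathExt_revPath u hs) (pathExt_revPath u ht)

theorem norm_sub_constPath_lt {f : E → E} {u : C(I, E)} {x₀ : E} {r : ℝ} (hr : 0 < r)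
    (hu : IsIntegralCurveOn (pathExt u) (fun _ => f) I) (h0 : ‖u 0 - x₀‖ ≤ r / 4)
    (hf : ∀ y, ‖y - x₀‖ ≤ r → ‖f y‖ < r / 2) : ‖u - constPath x₀‖ < r := by
  have bound := image_norm_le_of_norm_deriv_right_lt_deriv_boundary (a := 0) (b := 1)
    (f := fun t => pathExt u t - x₀) (B := fun t => r / 4 + r / 2 * t) (B' := fun _ => r / 2)
    (by fun_prop)
    (fun t ht => ((hu t ⟨ht.1, ht.2.le⟩).sub_const x₀).mono_of_mem_nhdsWithin
      (Icc_mem_nhdsGE_of_mem ht))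
    (by simpa [pathExt_zero] using h0)
    (fun t => by simpa using ((hasDerivAt_id t).const_mul (r / 2)).const_add (r / 4))
    (fun t ht on_boundary => hf _ (by rw [on_boundary]; nlinarith [ht.1, ht.2]))
  refine lt_of_le_of_lt ((ContinuousMap.norm_le _ (by positivity)).2 fun t => ?_)
    (by linarith : 3 * r / 4 < r)
  have bound_t := bound t.2
  rw [pathExt_coe] at bound_t
  exact bound_t.trans (by nlinarith [t.2.1, t.2.2])

theorem eventually_forall_orbit_mem [ProperSpace E] {w : C(E × E, E)} (hw : ∀ y, w (y, 0) = 0)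
    {x₀ : E} {N : Set C(I, E)} (hN : N ∈ 𝓝 (constPath x₀)) :
    ∀ᶠ z in 𝓝 (x₀, (0 : E)), ∀ u : C(I, E), u 0 = z.1 →
      IsIntegralCurveOn (pathExt u) (fun _ y => w (y, z.2)) I → u ∈ N := by
  obtain ⟨r, hr, ball_subset⟩ := Metric.mem_nhds_iff.1 hN
  have small_velocity : ∀ᶠ q in 𝓝 (0 : E), ∀ y ∈ Metric.closedBall x₀ r, ‖w (y, q)‖ < r / 2 := by
    refine (isCompact_closedBall x₀ r).eventually_forall_of_forall_eventually fun y _ => ?_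
    have norm_continuous : Continuous fun z : E × E => ‖w (z.2, z.1)‖ := by fun_prop
    refine norm_continuous.continuousAt.eventually_lt continuousAt_const ?_
    simpa [hw] using hr
  have near_start : ∀ᶠ y in 𝓝 x₀, ‖y - x₀‖ < r / 4 := by
    filter_upwards [Metric.ball_mem_nhds x₀ (by positivity : 0 < r / 4)] with y hy
    exact mem_ball_iff_norm.1 hy
  filter_upwards [near_start.prod_nhds small_velocity] with z hz u hu0 hu
  exact ball_subset (mem_ball_iff_norm.2 (norm_sub_constPath_lt hr hu (hu0 ▸ hz.1.le) fun y hy =>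
    hz.2 y (mem_closedBall_iff_norm.2 hy)))

/-- `A(x, q)` is a smooth family of orbits of `w(·, q)` with mean `x`, defined for `(x, q)` in a
neighbourhood `O` of `{q = 0}` and consisting of the only such orbits which are nearly constant. -/
structure IsOrbitFamily (w : E × E → E) (O : Set (E × E)) (A : E × E → C(I, E)) : Prop where
  isOpen : IsOpen O
  zero_mem : ∀ x, (x, 0) ∈ O
  smooth : ContDiffOn ℝ ∞ A O
  isOrbitWithMean : ∀ v ∈ O, IsOrbitWithMean w v (A v)
  unique : ∀ x, ∀ᶠ z in 𝓝 ((x, 0), constPath x), IsOrbitWithMean w z.1 z.2 → A z.1 = z.2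

theorem fderiv_deviationDefect_comp_inr {w : C(E × E, E)} (hw : ContDiff ℝ ∞ w)
    (hw0 : ∀ y, w (y, 0) = 0) (x : E) :
    fderiv ℝ (deviationDefect w) ((x, 0), 0) ∘L .inr ℝ (E × E) C(I, E) = .id ℝ C(I, E) := by
  have chain := ((contDiff_deviationDefect hw).differentiable (by simp)
    ((x, 0), 0)).hasFDerivAt.comp (0 : C(I, E)) (hasFDerivAt_prodMk_right (x, (0 : E)) 0)
  have comp_eq_id : (deviationDefect w ∘ fun η => ((x, 0), η)) = id :=
    funext (deviationDefect_zero hw0 x)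
  rw [comp_eq_id] at chain
  exact chain.unique (hasFDerivAt_id 0)

theorem IsOrbitFamily.eventually_eq_of_start_near [ProperSpace E] {w : C(E × E, E)}
    {O : Set (E × E)} {A : E × E → C(I, E)} (hA : IsOrbitFamily w O A)
    (hw0 : ∀ y, w (y, 0) = 0) (x : E) :
    ∀ᶠ z : (E × E) × E in 𝓝 ((x, 0), x), ∀ u : C(I, E), u 0 = z.2 → IsOrbitWithMean w z.1 u →
      A z.1 = u := by
  have unique := hA.unique x
  rw [nhds_prod_eq] at unique
  obtain ⟨P, hP, Q, hQ, unique⟩ := eventually_prod_iff.1 unique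
  have start_tendsto : Tendsto (fun z : (E × E) × E => (z.2, z.1.2)) (𝓝 ((x, 0), x))
      (𝓝 (x, 0)) := (continuous_snd.prodMk (continuous_snd.comp continuous_fst)).tendsto _
  filter_upwards [continuousAt_fst.eventually hP,
    start_tendsto.eventually (eventually_forall_orbit_mem hw0 hQ)] with z hz near u hu0 hu
  exact unique hz (near u hu0 hu.isIntegralCurveOn) hu

variable [CompleteSpace E]

theorem mean_constPath (x : E) : mean (constPath x) = x := by
  change ∫ _ in (0 : ℝ)..1, x = x
  simp

theorem hasDerivWithinAt_constPath_add_primitive (a : E) (g : C(I, E)) {t : ℝ} (ht : t ∈ I) :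
    HasDerivWithinAt (pathExt (constPath a + primitive g)) (pathExt g t) I t :=
  ((((pathExt g).continuous.integral_hasStrictDerivAt 0 t).hasDerivAt.const_add
    a).hasDerivWithinAt).congr (fun _ hs => pathExt_of_mem _ hs) (pathExt_of_mem _ ht)

theorem eq_constPath_add_primitive {u g : C(I, E)}
    (h : ∀ t ∈ I, HasDerivWithinAt (pathExt u) (pathExt g t) I t) :
    u = constPath (u 0) + primitive g := by
  ext t
  have increment := intervalIntegral.integral_eq_sub_of_hasDerivAt_of_le (f := pathExt u)
    (f' := pathExt g) t.2.1 (pathExt u).continuous.continuousOn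
    (fun s hs => (h s ⟨hs.1.le, hs.2.le.trans t.2.2⟩).hasDerivAt
      (Icc_mem_nhds hs.1 (hs.2.trans_le t.2.2)))
    ((pathExt g).continuous.intervalIntegrable _ _)
  rw [ContinuousMap.add_apply, primitive_apply, increment, pathExt_coe, pathExt_zero]
  exact (add_sub_cancel _ _).symm

theorem deviationDefect_eq_zero_iff {w : C(E × E, E)} {x q : E} {u : C(I, E)} :
    deviationDefect w ((x, q), u - constPath x) = 0 ↔ IsOrbitWithMean w (x, q) u := by
  set g := w.comp (deviate ((x, q), u - constPath x)) with hg
  have g_apply : ∀ t ∈ I, pathExt g t = w (pathExt u t, q) := fun t ht => by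
    simp [pathExt_of_mem _ ht, hg, deviate_apply]
  have defect : deviationDefect w ((x, q), u - constPath x)
      = u - (constPath (x - mean (primitive g)) + primitive g) := by
    change u - constPath x - (primitive g - constPath (mean (primitive g))) = _
    rw [map_sub]
    abel
  rw [defect, sub_eq_zero]
  constructor
  · intro hu
    refine ⟨fun t ht => ?_, ?_⟩
    · change HasDerivWithinAt _ (w (pathExt u t, q)) I t
      rw [← g_apply t ht, hu]
      exact hasDerivWithinAt_constPath_add_primitive _ g ht
    · rw [hu, map_add, mean_constPath, sub_add_cancel]
  · rintro ⟨hu, mean_eq⟩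
    have u_eq := eq_constPath_add_primitive (g := g) fun t ht => by
      rw [g_apply t ht]
      exact hu t ht
    have x_eq : x = u 0 + mean (primitive g) := by
      rw [← mean_constPath (u 0), ← map_add, ← u_eq]
      exact mean_eq.symm
    rw [x_eq, add_sub_cancel_right]
    exact u_eq

theorem isOrbitWithMean_zero_iff {w : C(E × E, E)} (hw : ∀ y, w (y, 0) = 0) {x : E}
    {u : C(I, E)} : IsOrbitWithMean w (x, 0) u ↔ u = constPath x := by
  rw [← deviationDefect_eq_zero_iff, deviationDefect_zero hw, sub_eq_zero]

theorem exists_isOrbitFamily {w : C(E × E, E)} (hw : ContDiff ℝ ∞ w) (hw0 : ∀ y, w (y, 0) = 0) :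
    ∃ O A, IsOrbitFamily w O A := by
  obtain ⟨O, O_open, zero_subset, ψ, ψ_smooth, ψ_solves, ψ_unique⟩ :=
    exists_implicitFunction_along (S := {v : E × E | v.2 = 0}) (contDiff_deviationDefect hw)
      (by simp)
      (by rintro ⟨x, -⟩ rfl; exact deviationDefect_zero hw0 x 0)
      (by
        rintro ⟨x, -⟩ rfl
        rw [fderiv_deviationDefect_comp_inr hw hw0]
        exact ⟨.refl ℝ _, rfl⟩)
  refine ⟨O, fun v => constPath v.1 + ψ v, O_open, fun x => zero_subset rfl,
    (constPath (E := E).contDiff.comp contDiff_fst).contDiffOn.add ψ_smooth, fun v hv => ?_,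
    fun x => ?_⟩
  · rw [← deviationDefect_eq_zero_iff, add_sub_cancel_left]
    exact ψ_solves v hv
  · have deviation_tendsto : Tendsto (fun z : (E × E) × C(I, E) => (z.1, z.2 - constPath z.1.1))
        (𝓝 ((x, 0), constPath x)) (𝓝 ((x, 0), 0)) := by
      have deviation_continuous :
          Continuous fun z : (E × E) × C(I, E) => (z.1, z.2 - constPath z.1.1) := by fun_prop
      simpa using deviation_continuous.tendsto ((x, 0), constPath x)
    filter_upwards [deviation_tendsto.eventually (ψ_unique (x, 0) rfl)] with z unique hz
    rw [unique (deviationDefect_eq_zero_iff.2 hz), add_sub_cancel]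

namespace IsOrbitFamily

variable {w : C(E × E, E)} {O : Set (E × E)} {A : E × E → C(I, E)}

theorem apply_zero (hA : IsOrbitFamily w O A) (hw0 : ∀ y, w (y, 0) = 0) (x : E) :
    A (x, 0) = constPath x :=
  (isOrbitWithMean_zero_iff hw0).1 (hA.isOrbitWithMean _ (hA.zero_mem x))

theorem tendsto (hA : IsOrbitFamily w O A) (hw0 : ∀ y, w (y, 0) = 0) (x : E) :
    Tendsto A (𝓝 (x, 0)) (𝓝 (constPath x)) := by
  rw [← hA.apply_zero hw0]
  exact (hA.smooth.contDiffAt (hA.isOpen.mem_nhds (hA.zero_mem x))).continuousAt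

theorem eventually_revPath_eq (hA : IsOrbitFamily w O A) (hw0 : ∀ y, w (y, 0) = 0)
    (hw : ∀ y q, w (y, -q) = -w (y, q)) (x : E) :
    ∀ᶠ v in 𝓝 (x, (0 : E)), A (v.1, -v.2) = revPath (A v) := by
  have rev_tendsto : Tendsto (fun v => revPath (A v)) (𝓝 (x, 0)) (𝓝 (constPath x)) :=
    ((ContinuousMap.continuous_precomp _).tendsto (constPath x)).comp (hA.tendsto hw0 x)
  filter_upwards [hA.isOpen.mem_nhds (hA.zero_mem x),
    ((tendsto_neg_snd_nhds_zero x).prodMk_nhds rev_tendsto).eventually (hA.unique x)]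
    with v hv unique
  exact unique (IsOrbitWithMean.revPath hw (hA.isOrbitWithMean v hv))

end IsOrbitFamily

end Paths

/-! ### The Karasev map -/

section Karasev

open unitInterval

variable {d : ℕ} {π : Coord d → Matrix (Fin d) (Fin d) ℝ}

theorem contDiff_spray_fst (hπ : ∀ i j, ContDiff ℝ ∞ (fun x => π x i j)) :
    ContDiff ℝ ∞ (fun z : Coord d × Coord d => (spray π z).1) := by
  rw [contDiff_pi]
  refine fun j => (ContDiff.sum fun i _ => ?_).neg
  exact ((hπ i j).comp contDiff_fst).mul (by fun_prop)

/-- The velocity `(y, q) ↦ -π^{ij}(y) q_i` of the base point of an integral curve of the spray. -/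
def velocity (hπ : ∀ i j, ContDiff ℝ ∞ (fun x => π x i j)) :
    C(Coord d × Coord d, Coord d) := ⟨fun z => (spray π z).1, (contDiff_spray_fst hπ).continuous⟩

variable (hπ : ∀ i j, ContDiff ℝ ∞ (fun x => π x i j))

theorem velocity_apply (y q : Coord d) (j : Fin d) :
    velocity hπ (y, q) j = -∑ i, π y i j * q i := rfl

theorem velocity_smul (r : ℝ) (y q : Coord d) :
    velocity hπ (y, r • q) = r • velocity hπ (y, q) := by
  funext j
  simp only [velocity_apply, Pi.smul_apply, smul_eq_mul, mul_left_comm _ r, mul_neg,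
    Finset.mul_sum]

theorem velocity_zero (y : Coord d) : velocity hπ (y, 0) = 0 := by
  simpa using velocity_smul hπ 0 y 0

theorem velocity_neg (y q : Coord d) : velocity hπ (y, -q) = -velocity hπ (y, q) := by
  simpa using velocity_smul hπ (-1) y q

theorem snd_eq_of_isIntegralCurveOn_smul_spray {ε : ℝ} {γ : ℝ → Coord d × Coord d}
    (hγ : IsIntegralCurveOn γ (fun _ z => ε • spray π z) I) {t : ℝ} (ht : t ∈ I) :
    (γ t).2 = (γ 0).2 := by
  have deriv_snd : ∀ t ∈ I, HasDerivWithinAt (fun t => (γ t).2) 0 I t := fun t ht => by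
    simpa [spray] using! (ContinuousLinearMap.snd ℝ (Coord d)
      (Coord d)).hasFDerivAt.comp_hasDerivWithinAt t (hγ t ht)
  exact constant_of_derivWithin_zero (fun t ht => (deriv_snd t ht).differentiableWithinAt)
    (fun t ht => (deriv_snd t (Set.Ico_subset_Icc_self ht)).derivWithin
      (uniqueDiffOn_Icc zero_lt_one t (Set.Ico_subset_Icc_self ht))) t ht

theorem preimage_mul_const_uIcc_zero {ε : ℝ} (hε : ε ≠ 0) : (· * ε) ⁻¹' Set.uIcc 0 ε = I := by
  rw [Set.preimage_mul_const_uIcc hε, zero_div, div_self hε, Set.uIcc_of_le zero_le_one]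

theorem IsXAverage.exists_orbit {ε : ℝ} {y p x : Coord d} (h : IsXAverage π ε y p x) :
    ∃ u : C(I, Coord d), u 0 = y ∧ IsOrbitWithMean (velocity hπ) (x, ε • p) u := by
  obtain ⟨γ, hγ0, hγ, hx⟩ := h
  rcases eq_or_ne ε 0 with rfl | hε
  · rw [if_pos rfl] at hx
    refine ⟨constPath x, hx, ?_⟩
    rw [zero_smul, isOrbitWithMean_zero_iff (velocity_zero hπ)]
  rw [if_neg hε] at hx
  have rescaled : IsIntegralCurveOn (γ ∘ (· * ε)) (fun _ z => ε • spray π z) I :=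
    (hγ.comp_mul ε).mono (preimage_mul_const_uIcc_zero hε).ge
  have momentum : ∀ t ∈ I, (γ (t * ε)).2 = p := fun t ht => by
    simpa [hγ0] using snd_eq_of_isIntegralCurveOn_smul_spray rescaled ht
  let u : C(I, Coord d) := ⟨fun t => (γ (t * ε)).1, rescaled.continuousOn.fst.domRestrict⟩
  have u_eq : Set.EqOn (pathExt u) (fun t => (γ (t * ε)).1) I := fun t ht => pathExt_of_mem u ht
  refine ⟨u, by simp [← pathExt_zero, u_eq ⟨le_rfl, zero_le_one⟩, hγ0], fun t ht => ?_, ?_⟩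
  · have deriv_fst := (ContinuousLinearMap.fst ℝ (Coord d)
      (Coord d)).hasFDerivAt.comp_hasDerivWithinAt t (rescaled t ht)
    change HasDerivWithinAt _ (velocity hπ (_, ε • p)) I t
    rw [velocity_smul, u_eq ht, ← momentum t ht]
    exact deriv_fst.congr u_eq (u_eq ht)
  · rw [mean_apply, intervalIntegral.integral_congr (u_eq.mono (Set.uIcc_of_le zero_le_one).le),
      intervalIntegral.integral_comp_mul_right (fun s => (γ s).1) hε, zero_mul, one_mul, hx]

theorem IsOrbitWithMean.isXAverage {ε : ℝ} {x p : Coord d} {u : C(I, Coord d)}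
    (hu : IsOrbitWithMean (velocity hπ) (x, ε • p) u) : IsXAverage π ε (u 0) p x := by
  refine ⟨fun s => (pathExt u (s / ε), p), by simp [pathExt_zero], fun s hs => ?_, ?_⟩
  · rcases eq_or_ne ε 0 with rfl | hε
    · rw [Set.uIcc_self, Set.mem_singleton_iff] at hs
      rw [Set.uIcc_self, hs]
      exact HasFDerivWithinAt.of_subsingleton Set.subsingleton_singleton
    have maps : Set.MapsTo (· / ε) (Set.uIcc 0 ε) I := fun s hs => by
      rwa [← preimage_mul_const_uIcc_zero hε, Set.mem_preimage, div_mul_cancel₀ s hε]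
    have rescaled := (hu.isIntegralCurveOn (s / ε) (maps hs)).scomp s
      ((hasDerivWithinAt_id s _).div_const ε) maps
    have velocity_eq : (1 / ε) • velocity hπ (pathExt u (s / ε), ε • p)
        = velocity hπ (pathExt u (s / ε), p) := by
      rw [velocity_smul, smul_smul, one_div_mul_cancel hε, one_smul]
    exact (rescaled.congr_deriv velocity_eq).prodMk (hasDerivWithinAt_const s _ p)
  · split_ifs with hε
    · rw [hε, zero_smul, isOrbitWithMean_zero_iff (velocity_zero hπ)] at hu
      simp [hu]
    · rw [intervalIntegral.integral_comp_div (pathExt u) hε, smul_smul, inv_mul_cancel₀ hε,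
        one_smul, zero_div, div_self hε, ← mean_apply]
      exact hu.mean_eq.symm

theorem IsOrbitFamily.isKarasevMap {O : Set (Coord d × Coord d)}
    {A : Coord d × Coord d → C(I, Coord d)} (hA : IsOrbitFamily (velocity hπ) O A) :
    IsKarasevMap π ((fun w : ℝ × Coord d × Coord d => (w.2.1, w.1 • w.2.2)) ⁻¹' O)
      (fun ε x p => A (x, ε • p) 0) where
  isOpen := hA.isOpen.preimage (by fun_prop)
  zero_mem x p := by simpa using hA.zero_mem x
  section_mem ε x := by simpa using hA.zero_mem x
  smooth := by
    have smooth_orbit : ContDiffOn ℝ ∞ (fun w : ℝ × Coord d × Coord d => A (w.2.1, w.1 • w.2.2))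
        ((fun w : ℝ × Coord d × Coord d => (w.2.1, w.1 • w.2.2)) ⁻¹' O) :=
      hA.smooth.comp (by fun_prop) (Set.mapsTo_preimage _ _)
    exact (ContinuousMap.evalCLM (M := Coord d) ℝ (0 : I)).contDiff.comp_contDiffOn smooth_orbit
  relation _ _ _ hz := (hA.isOrbitWithMean _ hz).isXAverage hπ

theorem exists_isKarasevMap (hπ : ∀ i j, ContDiff ℝ ∞ (fun x => π x i j)) :
    ∃ U α, IsKarasevMap π U α := by
  obtain ⟨O, A, hA⟩ :=
    exists_isOrbitFamily (w := velocity hπ) (contDiff_spray_fst hπ) (velocity_zero hπ)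
  exact ⟨_, _, hA.isKarasevMap hπ⟩

section Uniqueness

variable {U : Set (ℝ × Coord d × Coord d)} {α : ℝ → Coord d → Coord d → Coord d}
  {O : Set (Coord d × Coord d)} {A : Coord d × Coord d → C(I, Coord d)}

include hπ in
theorem IsKarasevMap.apply_zero (hα : IsKarasevMap π U α) (ε : ℝ) (x : Coord d) :
    α ε x 0 = x := by
  obtain ⟨u, u_zero, hu⟩ := (hα.relation ε x 0 (hα.section_mem ε x)).exists_orbit hπ
  rw [smul_zero, isOrbitWithMean_zero_iff (velocity_zero hπ)] at hu
  simp [← u_zero, hu]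

theorem IsKarasevMap.eventually_eq_orbit (hα : IsKarasevMap π U α)
    (hA : IsOrbitFamily (velocity hπ) O A) (ε : ℝ) (x : Coord d) :
    ∀ᶠ z : Coord d × Coord d in 𝓝 (x, 0), α ε z.1 z.2 = A (z.1, ε • z.2) 0 := by
  have slice : ContinuousAt (fun z : Coord d × Coord d => (ε, z)) (x, 0) := by fun_prop
  have mem_U : U ∈ 𝓝 (ε, x, (0 : Coord d)) := hα.isOpen.mem_nhds (hα.section_mem ε x)
  have start_tendsto : Tendsto (fun z : Coord d × Coord d => α ε z.1 z.2) (𝓝 (x, 0)) (𝓝 x) := by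
    have continuous := ((hα.smooth.contDiffAt mem_U).continuousAt).comp slice
    simpa only [ContinuousAt, Function.comp_def, hα.apply_zero hπ] using continuous
  filter_upwards [slice.eventually mem_U,
    ((tendsto_smul_snd_nhds_zero ε x).prodMk_nhds start_tendsto).eventually
      (hA.eventually_eq_of_start_near (velocity_zero hπ) x)] with z hz orbit_eq
  obtain ⟨u, u_zero, hu⟩ := (hα.relation ε z.1 z.2 hz).exists_orbit hπ
  rw [orbit_eq u u_zero hu, u_zero]

theorem IsKarasevMap.eventually_neg_eq_orbit (hα : IsKarasevMap π U α)
    (hA : IsOrbitFamily (velocity hπ) O A) (ε : ℝ) (x : Coord d) :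
    ∀ᶠ z : Coord d × Coord d in 𝓝 (x, 0), α ε z.1 (-z.2) = A (z.1, ε • z.2) 1 := by
  filter_upwards [(tendsto_neg_snd_nhds_zero x).eventually (hα.eventually_eq_orbit hπ hA ε x),
    (tendsto_smul_snd_nhds_zero ε x).eventually
      (hA.eventually_revPath_eq (velocity_zero hπ) (velocity_neg hπ) x)]
    with z orbit_eq rev_eq
  rw [orbit_eq, smul_neg, rev_eq]
  simp [revPath]

end Uniqueness

end Karasev

/-! ### Linear equations in a Banach algebra -/

section LinearODE

open unitInterval

variable {R : Type*} [NormedRing R] [NormedAlgebra ℝ R]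

theorem eqOn_of_hasDerivWithinAt_mul_add_mul {A B X Y f : ℝ → R} (hA : ContinuousOn A I)
    (hB : ContinuousOn B I) (hX : ∀ t ∈ I, HasDerivWithinAt X (A t * X t + X t * B t + f t) I t)
    (hY : ∀ t ∈ I, HasDerivWithinAt Y (A t * Y t + Y t * B t + f t) I t) (h0 : X 0 = Y 0) :
    Set.EqOn X Y I := by
  obtain ⟨a, ha⟩ := isCompact_Icc.exists_bound_of_continuousOn hA
  obtain ⟨b, hb⟩ := isCompact_Icc.exists_bound_of_continuousOn hB
  have difference : ∀ t ∈ I, HasDerivWithinAt (fun t => X t - Y t)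
      (A t * (X t - Y t) + (X t - Y t) * B t) I t := fun t ht =>
    ((hX t ht).sub (hY t ht)).congr_deriv (by noncomm_ring)
  have vanishes := eq_zero_of_abs_deriv_le_mul_abs_self_of_eq_zero_right (K := a + b)
    (fun t ht => (difference t ht).continuousWithinAt)
    (fun t ht => (difference t (Set.Ico_subset_Icc_self ht)).mono_of_mem_nhdsWithin
      (Icc_mem_nhdsGE_of_mem ht))
    (sub_eq_zero.2 h0) fun t ht => by
      have ht := Set.Ico_subset_Icc_self ht
      calc ‖A t * (X t - Y t) + (X t - Y t) * B t‖
          ≤ ‖A t‖ * ‖X t - Y t‖ + ‖X t - Y t‖ * ‖B t‖ :=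
            norm_add_le_of_le (norm_mul_le _ _) (norm_mul_le _ _)
        _ ≤ a * ‖X t - Y t‖ + ‖X t - Y t‖ * b := by gcongr; exacts [ha t ht, hb t ht]
        _ = (a + b) * ‖X t - Y t‖ := by ring
  exact fun t ht => sub_eq_zero.1 (vanishes t ht)

variable [StarRing R] [ContinuousStar R] [StarModule ℝ R] {A W Z P : ℝ → R}

theorem eqOn_conj_of_transport (hA : ContinuousOn A I)
    (hW : ∀ t ∈ I, HasDerivWithinAt W (A t * W t) I t)
    (hP : ∀ t ∈ I, HasDerivWithinAt P (A t * P t + P t * star (A t)) I t) {C : R}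
    (hC : P 0 = W 0 * C * star (W 0)) : Set.EqOn P (fun t => W t * C * star (W t)) I := by
  refine eqOn_of_hasDerivWithinAt_mul_add_mul (f := 0) hA hA.star
    (fun t ht => by simpa using hP t ht) (fun t ht => ?_) hC
  refine (((hW t ht).mul_const C).mul (hW t ht).star).congr_deriv ?_
  rw [star_mul, Pi.zero_apply]
  noncomm_ring

variable [CompleteSpace R]

theorem eqOn_mul_add_integral_star (hA : ContinuousOn A I) (W_continuous : Continuous W)
    (hW : ∀ t ∈ I, HasDerivWithinAt W (A t * W t) I t)
    (hZ : ∀ t ∈ I, HasDerivWithinAt Z (A t * Z t + P t) I t) {C G : R}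
    (hP : Set.EqOn P (fun t => W t * C * star (W t)) I) (hG : Z 0 = W 0 * G) :
    Set.EqOn Z (fun t => W t * (G + C * star (∫ s in (0 : ℝ)..t, W s))) I := by
  refine eqOn_of_hasDerivWithinAt_mul_add_mul (B := 0) hA continuousOn_const
    (fun t ht => by simpa using hZ t ht) (fun t ht => ?_) (by simpa using hG)
  have deriv_integral := (W_continuous.integral_hasStrictDerivAt 0 t).hasDerivAt.hasDerivWithinAt
    (s := I)
  refine ((hW t ht).mul ((deriv_integral.star.const_mul C).const_add G)).congr_deriv ?_
  rw [hP ht, Pi.zero_apply]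
  noncomm_ring

/-- Integration by parts: with `F` the primitive of `W`, the derivative of `F C F*` is
`W C F* + F C W*`. -/
theorem add_eq_star_of_integral_eq_zero (W_continuous : Continuous W) {C G : R}
    (hC : star C = -C) (W_integral : ∫ t in (0 : ℝ)..1, W t = 1)
    (h : ∫ t in (0 : ℝ)..1, W t * (G + C * star (∫ s in (0 : ℝ)..t, W s)) = 0) :
    G + C = star G := by
  let F : ℝ → R := fun t => ∫ s in (0 : ℝ)..t, W s
  have F_deriv : ∀ t, HasDerivAt F (W t) t := fun t =>
    (W_continuous.integral_hasStrictDerivAt 0 t).hasDerivAt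
  have F_continuous : Continuous F := continuous_iff_continuousAt.2 fun t =>
    (F_deriv t).continuousAt
  let L : ℝ → R := fun t => ∫ s in (0 : ℝ)..t, W s * (G + C * star (F s))
  have L_deriv : ∀ t, HasDerivAt L (W t * (G + C * star (F t))) t := fun t =>
    (Continuous.integral_hasStrictDerivAt (by fun_prop) 0 t).hasDerivAt
  have conserved : ∀ t, HasDerivAt
      (fun t => F t * C * star (F t) + F t * G - star G * star (F t) - L t + star (L t)) 0 t :=
    fun t => by
      refine ((((((F_deriv t).mul_const C).mul (F_deriv t).star).add ((F_deriv t).mul_const G)).sub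
        ((F_deriv t).star.const_mul (star G))).sub (L_deriv t)).add (L_deriv t).star
          |>.congr_deriv ?_
      simp only [star_mul, star_add, star_star, hC]
      noncomm_ring
  have endpoints := is_const_of_deriv_eq_zero (fun t => (conserved t).differentiableAt)
    (fun t => (conserved t).deriv) 1 0
  have F_one : F 1 = 1 := W_integral
  have L_one : L 1 = 0 := h
  have F_zero : F 0 = 0 := intervalIntegral.integral_same
  have L_zero : L 0 = 0 := intervalIntegral.integral_same
  simp only [F_one, L_one, F_zero, L_zero, one_mul, mul_one, star_one, star_zero, mul_zero,
    zero_mul, add_zero, sub_zero] at endpoints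
  rw [add_comm]
  exact sub_eq_zero.1 endpoints

/-- The linear algebra behind the commutation of source and target: `W` and `Z` are the derivatives
of an orbit of mean `x` and momentum `q` with respect to `x` and `q`, and `P` is the Poisson tensor
along the orbit. -/
theorem mul_star_eq_mul_star_of_variation (hA : ContinuousOn A I) (W_continuous : Continuous W)
    (hW : ∀ t ∈ I, HasDerivWithinAt W (A t * W t) I t)
    (hZ : ∀ t ∈ I, HasDerivWithinAt Z (A t * Z t + P t) I t)
    (hP : ∀ t ∈ I, HasDerivWithinAt P (A t * P t + P t * star (A t)) I t)
    (P_skew : star (P 0) = -P 0) (W_unit : IsUnit (W 0)) (W_integral : ∫ t in (0 : ℝ)..1, W t = 1)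
    (Z_integral : ∫ t in (0 : ℝ)..1, Z t = 0) : W 0 * star (Z 1) = Z 0 * star (W 1) := by
  obtain ⟨w, hw⟩ := W_unit
  set V : R := ↑w⁻¹ with hV
  have W_V : W 0 * V = 1 := by rw [← hw, hV, w.mul_inv]
  have P_zero : P 0 = W 0 * (V * P 0 * star V) * star (W 0) := by
    rw [← mul_assoc, ← mul_assoc, W_V, one_mul, mul_assoc, ← star_mul, W_V, star_one, mul_one]
  have Z_zero : Z 0 = W 0 * (V * Z 0) := by rw [← mul_assoc, W_V, one_mul]
  have Z_eq := eqOn_mul_add_integral_star hA W_continuous hW hZ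
    (eqOn_conj_of_transport hA hW hP P_zero) Z_zero
  have star_G : V * Z 0 + V * P 0 * star V = star (V * Z 0) := by
    refine add_eq_star_of_integral_eq_zero W_continuous ?_ W_integral ?_
    · simp [P_skew, mul_assoc]
    · rw [← Z_integral]
      refine (intervalIntegral.integral_congr ?_).symm
      exact Z_eq.mono (Set.uIcc_of_le zero_le_one).le
  have Z_one : Z 1 = W 1 * star (V * Z 0) := by
    rw [← star_G, Z_eq ⟨zero_le_one, le_rfl⟩]
    simp only [W_integral, star_one, mul_one]
  rw [Z_one, star_mul, star_star, ← mul_assoc, ← Z_zero]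

end LinearODE

/-! ### Commutation of source and target -/

section OrbitVariation

open unitInterval

variable {E : Type*} [NormedAddCommGroup E] [NormedSpace ℝ E] {w : C(E × E, E)}
  {O : Set (E × E)} {A : E × E → C(I, E)} {v : E × E}

namespace IsOrbitFamily

theorem differentiableAt (hA : IsOrbitFamily w O A) (hv : v ∈ O) : DifferentiableAt ℝ A v :=
  (hA.smooth.contDiffAt (hA.isOpen.mem_nhds hv)).differentiableAt (by simp)

theorem mean_fderiv (hA : IsOrbitFamily w O A) (hv : v ∈ O) (δ : E × E) :
    mean (fderiv ℝ A v δ) = δ.1 := by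
  have mean_eq : (fun v => mean (A v)) =ᶠ[𝓝 v] Prod.fst := by
    filter_upwards [hA.isOpen.mem_nhds hv] with v hv using (hA.isOrbitWithMean v hv).mean_eq
  have chain := (mean (E := E)).hasFDerivAt.comp v (hA.differentiableAt hv).hasFDerivAt
  exact DFunLike.congr_fun (chain.unique (hasFDerivAt_fst.congr_of_eventuallyEq mean_eq)) δ

variable [CompleteSpace E]

theorem fderiv_inl (hA : IsOrbitFamily w O A) (hw0 : ∀ y, w (y, 0) = 0) (x k : E) :
    fderiv ℝ A (x, 0) (k, 0) = constPath k := by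
  have chain : HasFDerivAt (A ∘ fun x => (x, 0)) _ x :=
    (hA.differentiableAt (hA.zero_mem x)).hasFDerivAt.comp x
      (hasFDerivAt_prodMk_left (𝕜 := ℝ) x (0 : E))
  have comp_eq : (A ∘ fun x => (x, 0)) = constPath := funext (hA.apply_zero hw0)
  rw [comp_eq] at chain
  exact DFunLike.congr_fun (chain.unique (constPath (E := E)).hasFDerivAt) k

theorem eq_constPath_add_primitive (hA : IsOrbitFamily w O A) (hv : v ∈ O) :
    A v = constPath (A v 0) + primitive (w.comp (deviate ((0, v.2), A v))) := by
  refine KHJ.eq_constPath_add_primitive fun t ht => ?_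
  rw [pathExt_of_mem _ ht, ContinuousMap.comp_apply, deviate_apply, zero_add, ← pathExt_of_mem _ ht]
  exact (hA.isOrbitWithMean v hv).isIntegralCurveOn t ht

theorem hasDerivWithinAt_fderiv (hA : IsOrbitFamily w O A) (hw : ContDiff ℝ ∞ w) (hv : v ∈ O)
    (δ : E × E) {t : ℝ} (ht : t ∈ I) :
    HasDerivWithinAt (pathExt (fderiv ℝ A v δ))
      (fderiv ℝ w (pathExt (A v) t, v.2) (pathExt (fderiv ℝ A v δ) t, δ.2)) I t := by
  let w' : C(E × E, E × E →L[ℝ] E) := ⟨fderiv ℝ w, hw.continuous_fderiv (by simp)⟩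
  have w_deriv : ∀ z, HasFDerivAt w (w' z) z := fun z =>
    (hw.differentiable (by simp) z).hasFDerivAt
  let g := pointwiseApply (w'.comp (deviate ((0, v.2), A v)))
    (deviate ((0, δ.2), fderiv ℝ A v δ))
  have A_deriv := (hA.differentiableAt hv).hasFDerivAt
  have integral_equation :
      A =ᶠ[𝓝 v] fun v => constPath (A v 0) + primitive (w.comp (deviate ((0, v.2), A v))) := by
    filter_upwards [hA.isOpen.mem_nhds hv] with v hv using hA.eq_constPath_add_primitive hv
  have start_deriv := ((constPath (E := E)).comp
    (ContinuousMap.evalCLM ℝ (0 : I))).hasFDerivAt.comp v A_deriv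
  have deviate_deriv := (deviate (E := E)).hasFDerivAt.comp v
    (((hasFDerivAt_const (0 : E) v).prodMk hasFDerivAt_snd).prodMk A_deriv)
  have primitive_deriv := (primitive (E := E)).hasFDerivAt.comp v
    ((hasFDerivAt_postcomp w_deriv _).comp v deviate_deriv)
  have linearized : fderiv ℝ A v δ = constPath (fderiv ℝ A v δ 0) + primitive g :=
    DFunLike.congr_fun (A_deriv.unique
      ((start_deriv.add primitive_deriv).congr_of_eventuallyEq integral_equation)) δ
  have deriv := hasDerivWithinAt_constPath_add_primitive (fderiv ℝ A v δ 0) g ht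
  rw [← linearized] at deriv
  refine deriv.congr_deriv ?_
  rw [pathExt_of_mem _ ht, pathExt_of_mem _ ht, pathExt_of_mem _ ht]
  change w' (deviate ((0, v.2), A v) _) (deviate ((0, δ.2), fderiv ℝ A v δ) _) = _
  rw [deviate_apply, deviate_apply, zero_add, zero_add]
  rfl

end IsOrbitFamily

end OrbitVariation

section Jacobi

open Matrix

variable {d : ℕ} {π : Coord d → Matrix (Fin d) (Fin d) ℝ}

/-- The linearization in `y` of the velocity at `(y, q)`. -/
noncomputable def velocityMatrix (π : Coord d → Matrix (Fin d) (Fin d) ℝ) (y q : Coord d) :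
    Matrix (Fin d) (Fin d) ℝ :=
  Matrix.of fun j l => -∑ i, differential (fun y => π y i j) y l * q i

theorem fderiv_apply_eq_sum {f : Coord d → ℝ} (y k : Coord d) :
    fderiv ℝ f y k = ∑ l, differential f y l * k l := by
  conv_lhs => rw [pi_eq_sum_univ' k]
  simp only [map_sum, map_smul, smul_eq_mul, differential, mul_comm]

theorem fderiv_mul_comp_snd {f : Coord d → ℝ} {y : Coord d} (hf : DifferentiableAt ℝ f y)
    (q k θ : Coord d) (i : Fin d) :
    fderiv ℝ (fun z : Coord d × Coord d => f z.1 * z.2 i) (y, q) (k, θ) =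
      f y * θ i + (∑ l, differential f y l * k l) * q i := by
  have base_deriv : HasFDerivAt (fun z : Coord d × Coord d => f z.1) _ (y, q) :=
    hf.hasFDerivAt.comp (f := Prod.fst) (y, q) hasFDerivAt_fst
  have momentum_deriv : HasFDerivAt (fun z : Coord d × Coord d => z.2 i) _ (y, q) :=
    ((ContinuousLinearMap.proj (R := ℝ) (φ := fun _ : Fin d => ℝ) i).comp
      (.snd ℝ (Coord d) (Coord d))).hasFDerivAt
  rw [(base_deriv.fun_mul momentum_deriv).fderiv, ← fderiv_apply_eq_sum]
  simp [mul_comm]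

theorem fderiv_velocity (hπ : IsPoissonTensor π) (y q k θ : Coord d) :
    fderiv ℝ (velocity hπ.smooth) (y, q) (k, θ) = velocityMatrix π y q *ᵥ k + π y *ᵥ θ := by
  have velocity_differentiable := (contDiff_spray_fst hπ.smooth).differentiable (by simp)
  have term_differentiable : ∀ i j, DifferentiableAt ℝ
      (fun z : Coord d × Coord d => π z.1 i j * z.2 i) (y, q) := fun i j =>
    ((((hπ.smooth i j).comp contDiff_fst).mul (by fun_prop)).differentiable (by simp)) _
  funext j
  calc fderiv ℝ (velocity hπ.smooth) (y, q) (k, θ) j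
      = fderiv ℝ (fun z : Coord d × Coord d => -∑ i, π z.1 i j * z.2 i) (y, q) (k, θ) :=
        DFunLike.congr_fun (fderiv_apply velocity_differentiable.differentiableAt j).symm (k, θ)
    _ = -∑ i, (π y i j * θ i + (∑ l, differential (fun y => π y i j) y l * k l) * q i) := by
        rw [fderiv_fun_neg, fderiv_fun_sum fun i _ => term_differentiable i j]
        simp [fderiv_mul_comp_snd ((hπ.smooth _ _).differentiable (by simp) y)]
    _ = (velocityMatrix π y q *ᵥ k + π y *ᵥ θ) j := by
        simp only [hπ.skew y j, Pi.add_apply, mulVec, dotProduct, velocityMatrix, of_apply,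
          Finset.sum_add_distrib, neg_mul, Finset.sum_neg_distrib, Finset.sum_mul, neg_add_rev,
          neg_neg]
        rw [Finset.sum_comm]
        simp only [mul_right_comm]

theorem sum_differential_velocity (hπ : IsPoissonTensor π) (y q : Coord d) (i j : Fin d) :
    ∑ l, differential (fun y => π y i j) y l * velocity hπ.smooth (y, q) l =
      (velocityMatrix π y q * π y + π y * (velocityMatrix π y q)ᵀ) i j := by
  have differential_skew : ∀ m l, differential (fun y => π y j m) y l
      = -differential (fun y => π y m j) y l := fun m l => by
    rw [show (fun y => π y j m) = -fun y => π y m j from funext fun y => hπ.skew y m j,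
      differential_neg, Pi.neg_apply]
  have contracted_jacobi : ∑ l, ∑ m, q m * (π y i l * differential (fun y => π y j m) y l
        + π y j l * differential (fun y => π y m i) y l
        + π y m l * differential (fun y => π y i j) y l) = 0 := by
    rw [Finset.sum_comm]
    exact Finset.sum_eq_zero fun m _ => by rw [← Finset.mul_sum, hπ.jacobi, mul_zero]
  rw [← sub_eq_zero, ← neg_eq_zero, ← contracted_jacobi]
  simp only [velocity_apply, Matrix.add_apply, mul_apply, transpose_apply, velocityMatrix,
    of_apply, Finset.mul_sum, Finset.sum_mul, mul_neg, neg_mul, ← Finset.sum_add_distrib,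
    ← Finset.sum_sub_distrib, ← Finset.sum_neg_distrib]
  refine Finset.sum_congr rfl fun l _ => Finset.sum_congr rfl fun m _ => ?_
  rw [hπ.skew y j l, differential_skew m l]
  ring

end Jacobi

section Bracket

open Matrix unitInterval
open scoped Matrix.Norms.L2Operator

variable {d : ℕ} {π : Coord d → Matrix (Fin d) (Fin d) ℝ}
  {w : C(Coord d × Coord d, Coord d)} {O : Set (Coord d × Coord d)}
  {A : Coord d × Coord d → C(I, Coord d)} {v : Coord d × Coord d}

/-- The matrix whose columns are the values at time `t` of the derivatives of the family of paths
`A` in the directions `δ k`. -/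
noncomputable def variationMatrix (A : Coord d × Coord d → C(I, Coord d))
    (δ : Fin d → Coord d × Coord d) (v : Coord d × Coord d) (t : ℝ) : Matrix (Fin d) (Fin d) ℝ :=
  Matrix.of fun j k => pathExt (fderiv ℝ A v (δ k)) t j

/-- The derivative at time `t` with respect to the mean of an orbit. -/
noncomputable def baseJacobian (A : Coord d × Coord d → C(I, Coord d)) :
    Coord d × Coord d → ℝ → Matrix (Fin d) (Fin d) ℝ :=
  variationMatrix A fun k => (Pi.single k 1, 0)

/-- The derivative at time `t` with respect to the momentum of an orbit. -/
noncomputable def momentumJacobian (A : Coord d × Coord d → C(I, Coord d)) :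
    Coord d × Coord d → ℝ → Matrix (Fin d) (Fin d) ℝ :=
  variationMatrix A fun k => (0, Pi.single k 1)

theorem hasDerivWithinAt_matrix {W : ℝ → Matrix (Fin d) (Fin d) ℝ} {W' : Matrix (Fin d) (Fin d) ℝ}
    {s : Set ℝ} {t : ℝ} (h : ∀ k, HasDerivWithinAt (fun t => (W t).col k) (W'.col k) s t) :
    HasDerivWithinAt W W' s t :=
  hasDerivWithinAt_pi.2 fun i => hasDerivWithinAt_pi.2 fun k => hasDerivWithinAt_pi.1 (h k) i

theorem continuous_variationMatrix (δ : Fin d → Coord d × Coord d) :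
    Continuous (variationMatrix A δ v) :=
  continuous_matrix fun j _ => (continuous_apply j).comp (pathExt _).continuous

theorem continuous_velocityMatrix (hπ : IsPoissonTensor π) (u : C(I, Coord d)) (q : Coord d) :
    Continuous fun t => velocityMatrix π (pathExt u t) q := by
  refine continuous_matrix fun j l => (continuous_finsetSum _ fun i _ => ?_).neg
  exact ((((hπ.smooth i j).continuous_fderiv (by simp)).comp (pathExt u).continuous).clm_apply
    continuous_const).mul continuous_const

theorem integral_variationMatrix (hA : IsOrbitFamily w O A) (hv : v ∈ O)
    (δ : Fin d → Coord d × Coord d) :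
    ∫ t in (0 : ℝ)..1, variationMatrix A δ v t = Matrix.of fun j k => (δ k).1 j := by
  ext j k
  let entry : Matrix (Fin d) (Fin d) ℝ →L[ℝ] ℝ :=
    (Matrix.entryLinearMap ℝ ℝ j k).toContinuousLinearMap
  have entry_integral := entry.intervalIntegral_comp_comm (μ := MeasureTheory.volume)
    ((continuous_variationMatrix (A := A) (v := v) δ).intervalIntegrable 0 1)
  have coord_integral := (ContinuousLinearMap.proj (R := ℝ) (φ := fun _ : Fin d => ℝ)
    j).intervalIntegral_comp_comm (μ := MeasureTheory.volume)
      ((pathExt (fderiv ℝ A v (δ k))).continuous.intervalIntegrable 0 1)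
  rw [← mean_apply, hA.mean_fderiv hv] at coord_integral
  exact entry_integral.symm.trans coord_integral

theorem hasDerivWithinAt_baseJacobian (hπ : IsPoissonTensor π)
    (hA : IsOrbitFamily (velocity hπ.smooth) O A) (hv : v ∈ O) {t : ℝ} (ht : t ∈ I) :
    HasDerivWithinAt (baseJacobian A v)
      (velocityMatrix π (pathExt (A v) t) v.2 * baseJacobian A v t) I t := by
  refine hasDerivWithinAt_matrix fun k => ?_
  refine (hA.hasDerivWithinAt_fderiv (contDiff_spray_fst hπ.smooth) hv _ ht).congr_deriv ?_
  rw [fderiv_velocity hπ, mulVec_zero, add_zero]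
  rfl

theorem hasDerivWithinAt_momentumJacobian (hπ : IsPoissonTensor π)
    (hA : IsOrbitFamily (velocity hπ.smooth) O A) (hv : v ∈ O) {t : ℝ} (ht : t ∈ I) :
    HasDerivWithinAt (momentumJacobian A v)
      (velocityMatrix π (pathExt (A v) t) v.2 * momentumJacobian A v t + π (pathExt (A v) t))
      I t := by
  refine hasDerivWithinAt_matrix fun k => ?_
  refine (hA.hasDerivWithinAt_fderiv (contDiff_spray_fst hπ.smooth) hv _ ht).congr_deriv ?_
  rw [fderiv_velocity hπ, mulVec_single_one]
  rfl

/-- This is the Jacobi identity. -/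
theorem hasDerivWithinAt_poissonTensor (hπ : IsPoissonTensor π) {u : C(I, Coord d)}
    {x q : Coord d} (hu : IsOrbitWithMean (velocity hπ.smooth) (x, q) u) {t : ℝ} (ht : t ∈ I) :
    HasDerivWithinAt (fun t => π (pathExt u t))
      (velocityMatrix π (pathExt u t) q * π (pathExt u t)
        + π (pathExt u t) * star (velocityMatrix π (pathExt u t) q)) I t := by
  refine hasDerivWithinAt_pi.2 fun i => hasDerivWithinAt_pi.2 fun j => ?_
  refine (((hπ.smooth i j).differentiable (by simp) _).hasFDerivAt.comp_hasDerivWithinAt t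
    (hu.isIntegralCurveOn t ht)).congr_deriv ?_
  rw [fderiv_apply_eq_sum, sum_differential_velocity hπ, star_eq_conjTranspose,
    conjTranspose_eq_transpose_of_trivial]

theorem baseJacobian_mul_transpose_momentumJacobian (hπ : IsPoissonTensor π)
    (hA : IsOrbitFamily (velocity hπ.smooth) O A) (hv : v ∈ O)
    (hunit : IsUnit (baseJacobian A v 0)) :
    baseJacobian A v 0 * (momentumJacobian A v 1)ᵀ
      = momentumJacobian A v 0 * (baseJacobian A v 1)ᵀ := by
  have base_integral : ∫ t in (0 : ℝ)..1, baseJacobian A v t = 1 := by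
    rw [baseJacobian, integral_variationMatrix hA hv]
    ext j k
    simp [Matrix.one_apply, Pi.single_apply]
  have momentum_integral : ∫ t in (0 : ℝ)..1, momentumJacobian A v t = 0 :=
    integral_variationMatrix hA hv _
  have endpoints := mul_star_eq_mul_star_of_variation (W := baseJacobian A v)
    (continuous_velocityMatrix hπ (A v) v.2).continuousOn (continuous_variationMatrix _)
    (fun t ht => hasDerivWithinAt_baseJacobian hπ hA hv ht)
    (fun t ht => hasDerivWithinAt_momentumJacobian hπ hA hv ht)
    (fun t ht => hasDerivWithinAt_poissonTensor hπ (hA.isOrbitWithMean v hv) ht)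
    (by ext i j; exact hπ.skew _ i j) hunit base_integral momentum_integral
  simpa only [star_eq_conjTranspose, conjTranspose_eq_transpose_of_trivial] using endpoints

theorem eventually_isUnit_baseJacobian (hA : IsOrbitFamily w O A) (hw0 : ∀ y, w (y, 0) = 0)
    (x : Coord d) : ∀ᶠ v in 𝓝 (x, (0 : Coord d)), IsUnit (baseJacobian A v 0) := by
  have at_zero : baseJacobian A (x, 0) 0 = 1 := by
    ext j k
    simp [baseJacobian, variationMatrix, pathExt_zero, hA.fderiv_inl hw0,
      Matrix.one_apply, Pi.single_apply]
  have fderiv_continuous : ContinuousAt (fderiv ℝ A) (x, 0) :=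
    ((hA.smooth.contDiffAt (hA.isOpen.mem_nhds (hA.zero_mem x))).fderiv_right (m := ∞)
      (by simp)).continuousAt
  have jacobian_continuous : ContinuousAt (fun v => baseJacobian A v 0) (x, 0) := by
    refine continuousAt_pi.2 fun j => continuousAt_pi.2 fun k => ?_
    have entry_continuous : Continuous fun u : C(I, Coord d) => pathExt u 0 j := by
      simp only [pathExt_zero]
      fun_prop
    exact entry_continuous.continuousAt.comp (fderiv_continuous.clm_apply continuousAt_const)
  refine jacobian_continuous.eventually (Units.isOpen.mem_nhds ?_)
  simp only [at_zero]
  exact isUnit_one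

end Bracket

section SourceTarget

open Matrix unitInterval

variable {d : ℕ} {π : Coord d → Matrix (Fin d) (Fin d) ℝ}
  {w : C(Coord d × Coord d, Coord d)} {O : Set (Coord d × Coord d)}
  {A : Coord d × Coord d → C(I, Coord d)}

theorem canonicalBracket_congr {a a' b b' : Coord d × Coord d → ℝ} {z : Coord d × Coord d}
    (ha : a =ᶠ[𝓝 z] a') (hb : b =ᶠ[𝓝 z] b') :
    canonicalBracket a b z = canonicalBracket a' b' z := by
  simp only [canonicalBracket, dirDeriv, ha.fderiv_eq, hb.fderiv_eq]

theorem vecMul_dotProduct_vecMul {R l m n : Type*} [CommSemiring R] [Fintype l] [Fintype m]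
    [Fintype n] (f : l → R) (g : m → R) (M : Matrix l n R) (N : Matrix m n R) :
    (f ᵥ* M) ⬝ᵥ (g ᵥ* N) = (f ᵥ* (M * Nᵀ)) ⬝ᵥ g := by
  rw [← mulVec_transpose N, dotProduct_mulVec, vecMul_vecMul]

theorem dirDeriv_comp_orbit (hA : IsOrbitFamily w O A) {H : Coord d → ℝ}
    (hH : Differentiable ℝ H) {ε : ℝ} {z : Coord d × Coord d} (hz : (z.1, ε • z.2) ∈ O) (t : I)
    (δ : Coord d × Coord d) :
    dirDeriv δ (fun z => H (A (z.1, ε • z.2) t)) z =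
      ∑ j, differential H (A (z.1, ε • z.2) t) j *
        fderiv ℝ A (z.1, ε • z.2) (δ.1, ε • δ.2) t j := by
  have scale_deriv : HasFDerivAt (fun z : Coord d × Coord d => (z.1, ε • z.2))
      ((ContinuousLinearMap.fst ℝ (Coord d) (Coord d)).prod
        (ε • ContinuousLinearMap.snd ℝ (Coord d) (Coord d))) z :=
    hasFDerivAt_fst.prodMk (hasFDerivAt_snd.const_smul ε)
  have point_deriv : HasFDerivAt (fun z => A (z.1, ε • z.2) t) _ z :=
    (ContinuousMap.evalCLM (M := Coord d) ℝ t).hasFDerivAt.comp z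
      ((hA.differentiableAt hz).hasFDerivAt.comp z scale_deriv)
  have chain := ((hH _).hasFDerivAt.comp z point_deriv).fderiv
  rw [← fderiv_apply_eq_sum]
  exact DFunLike.congr_fun chain δ

theorem dirDeriv_inl_comp_orbit (hA : IsOrbitFamily w O A) {H : Coord d → ℝ}
    (hH : Differentiable ℝ H) {ε : ℝ} {z : Coord d × Coord d} (hz : (z.1, ε • z.2) ∈ O) (t : I)
    (k : Fin d) :
    dirDeriv (Pi.single k 1, 0) (fun z => H (A (z.1, ε • z.2) t)) z =
      (differential H (A (z.1, ε • z.2) t) ᵥ* baseJacobian A (z.1, ε • z.2) t) k := by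
  rw [dirDeriv_comp_orbit hA hH hz, smul_zero]
  simp only [vecMul, dotProduct, baseJacobian, variationMatrix, of_apply, pathExt_coe]

theorem dirDeriv_inr_comp_orbit (hA : IsOrbitFamily w O A) {H : Coord d → ℝ}
    (hH : Differentiable ℝ H) {ε : ℝ} {z : Coord d × Coord d} (hz : (z.1, ε • z.2) ∈ O) (t : I)
    (k : Fin d) :
    dirDeriv (0, Pi.single k 1) (fun z => H (A (z.1, ε • z.2) t)) z =
      ε * (differential H (A (z.1, ε • z.2) t) ᵥ* momentumJacobian A (z.1, ε • z.2) t) k := by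
  have scaled : ((0 : Coord d), ε • (Pi.single k 1 : Coord d)) = ε • (0, Pi.single k 1) := by
    rw [Prod.smul_mk, smul_zero]
  rw [dirDeriv_comp_orbit hA hH hz, scaled]
  simp only [vecMul, dotProduct, momentumJacobian, variationMatrix, of_apply, pathExt_coe,
    map_smul, ContinuousMap.smul_apply, Pi.smul_apply, smul_eq_mul, Finset.mul_sum,
    mul_left_comm ε]

theorem canonicalBracket_comp_orbit_eq_zero (hπ : IsPoissonTensor π)
    (hA : IsOrbitFamily (velocity hπ.smooth) O A) {H : Coord d → ℝ} (hH : Differentiable ℝ H)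
    {ε : ℝ} {z : Coord d × Coord d} (hz : (z.1, ε • z.2) ∈ O)
    (hunit : IsUnit (baseJacobian A (z.1, ε • z.2) 0)) :
    canonicalBracket (fun z => H (A (z.1, ε • z.2) 0)) (fun z => H (A (z.1, ε • z.2) 1)) z = 0 := by
  simp only [canonicalBracket, dirDeriv_inl_comp_orbit hA hH hz, dirDeriv_inr_comp_orbit hA hH hz]
  set v := (z.1, ε • z.2)
  set f := differential H (A v 0)
  set g := differential H (A v 1)
  calc _ = ε * ((f ᵥ* baseJacobian A v 0) ⬝ᵥ (g ᵥ* momentumJacobian A v 1)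
          - (f ᵥ* momentumJacobian A v 0) ⬝ᵥ (g ᵥ* baseJacobian A v 1)) := by
        simp only [dotProduct, ← Finset.sum_sub_distrib, Finset.mul_sum]
        exact Finset.sum_congr rfl fun k _ => by push_cast; ring
    _ = 0 := by
        rw [vecMul_dotProduct_vecMul, vecMul_dotProduct_vecMul,
          baseJacobian_mul_transpose_momentumJacobian hπ hA hz hunit, sub_self, mul_zero]

theorem IsKarasevMap.canonicalBracket_eq_zero (hπ : IsPoissonTensor π)
    {U : Set (ℝ × Coord d × Coord d)} {α : ℝ → Coord d → Coord d → Coord d}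
    (hα : IsKarasevMap π U α) {H : Coord d → ℝ} (hH : Differentiable ℝ H) (ε : ℝ) (x : Coord d) :
    ∀ᶠ z in 𝓝 (x, 0),
      canonicalBracket (sourcePullback α H ε) (sourcePullback α H ε ∘ reflect) z = 0 := by
  obtain ⟨O, A, hA⟩ := exists_isOrbitFamily (w := velocity hπ.smooth)
    (contDiff_spray_fst hπ.smooth) (velocity_zero hπ.smooth)
  have scale_tendsto := tendsto_smul_snd_nhds_zero ε x
  filter_upwards [(hα.eventually_eq_orbit hπ.smooth hA ε x).eventually_nhds,
    (hα.eventually_neg_eq_orbit hπ.smooth hA ε x).eventually_nhds,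
    scale_tendsto.eventually (hA.isOpen.mem_nhds (hA.zero_mem x)),
    scale_tendsto.eventually (eventually_isUnit_baseJacobian hA (velocity_zero hπ.smooth) x)]
    with z source_eq target_eq hz hunit
  exact (canonicalBracket_congr (source_eq.mono fun z h => congrArg H h)
    (target_eq.mono fun z h => congrArg H h)).trans
      (canonicalBracket_comp_orbit_eq_zero hπ hA hH hz hunit)

end SourceTarget

/-! ### Maps close to the identity -/

section NearIdentity

open Metric

variable {E : Type*} [NormedAddCommGroup E]

theorem eventually_norm_sub_self_lt {P : Type*} [TopologicalSpace P] [Zero P] {f : P × E → E}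
    (hf : Continuous f) (h0 : ∀ x, f (0, x) = x) {K : Set E} (hK : IsCompact K) {C : ℝ}
    (hC : 0 < C) : ∀ᶠ μ in 𝓝 (0 : P), ∀ x ∈ K, ‖f (μ, x) - x‖ < C :=
  hK.eventually_forall_of_forall_eventually fun x _ =>
    (hf.sub continuous_snd).norm.continuousAt.eventually_lt continuousAt_const
      (by simpa [h0] using hC)

variable [NormedSpace ℝ E]

theorem approximatesLinearOn_id_of_norm_fderiv_sub_le {g : E → E} {s : Set E} {C : NNReal}
    (hs : Convex ℝ s) (hg : ∀ x ∈ s, DifferentiableAt ℝ g x)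
    (hD : ∀ x ∈ s, ‖fderiv ℝ g x - ContinuousLinearMap.id ℝ E‖ ≤ C) :
    ApproximatesLinearOn g (ContinuousLinearMap.id ℝ E) s C := fun _ hx _ hy =>
  hs.norm_image_sub_le_of_norm_hasFDerivWithin_le'
    (fun z hz => (hg z hz).hasFDerivAt.hasFDerivWithinAt) hD hy hx

theorem exists_equiv_eq_of_norm_sub_id_lt_one [CompleteSpace E] {T : E →L[ℝ] E}
    (hT : ‖T - ContinuousLinearMap.id ℝ E‖ < 1) : ∃ e : E ≃L[ℝ] E, (e : E →L[ℝ] E) = T := by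
  have hT' : ‖(1 : E →L[ℝ] E) - T‖ < 1 := by rwa [norm_sub_rev]
  refine ⟨ContinuousLinearEquiv.unitsEquiv ℝ E (Units.oneSub _ hT'), ?_⟩
  ext1 x
  change ((Units.oneSub _ hT' : (E →L[ℝ] E)ˣ) : E →L[ℝ] E) x = T x
  rw [Units.val_oneSub, sub_sub_cancel]

theorem exists_contDiffOn_leftInverse_of_near_id [CompleteSpace E] {g : E → E} {s : Set E}
    {C : NNReal} (hC : C < 1) (hg : ContDiff ℝ ∞ g) (hs : IsOpen s) (hconv : Convex ℝ s)
    (hD : ∀ x ∈ s, ‖fderiv ℝ g x - ContinuousLinearMap.id ℝ E‖ ≤ C) :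
    IsOpen (g '' s) ∧ ∃ r : E → E, ContDiffOn ℝ ∞ r (g '' s) ∧ ∀ x ∈ s, r (g x) = x := by
  have approx : ApproximatesLinearOn g (ContinuousLinearEquiv.refl ℝ E : E →L[ℝ] E) s C :=
    approximatesLinearOn_id_of_norm_fderiv_sub_le hconv
      (fun x _ => hg.differentiable (by simp) x) hD
  have small : Subsingleton E ∨
      C < ‖((ContinuousLinearEquiv.refl ℝ E).symm : E →L[ℝ] E)‖₊⁻¹ := by
    rcases subsingleton_or_nontrivial E with h | h
    · exact Or.inl h
    · have norm_one : ‖((ContinuousLinearEquiv.refl ℝ E).symm : E →L[ℝ] E)‖₊ = 1 :=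
        NNReal.eq ContinuousLinearMap.norm_id
      exact Or.inr (by rwa [norm_one, inv_one])
  let Ψ := approx.toOpenPartialHomeomorph g s small hs
  refine ⟨Ψ.open_target, Ψ.symm, fun y hy => ?_, fun x hx => Ψ.left_inv hx⟩
  obtain ⟨e, he⟩ := exists_equiv_eq_of_norm_sub_id_lt_one
    ((hD (Ψ.symm y) (Ψ.map_target hy)).trans_lt (by exact_mod_cast hC))
  have deriv_eq : HasFDerivAt Ψ (e : E →L[ℝ] E) (Ψ.symm y) :=
    he ▸ (hg.differentiable (by simp) _).hasFDerivAt
  exact (Ψ.contDiffAt_symm hy deriv_eq hg.contDiffAt).contDiffWithinAt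

theorem closedBall_subset_image_of_near_id [CompleteSpace E] {g : E → E} {R : ℝ}
    (hg : ∀ x ∈ ball (0 : E) R, DifferentiableAt ℝ g x)
    (hD : ∀ x ∈ ball (0 : E) R, ‖fderiv ℝ g x - ContinuousLinearMap.id ℝ E‖ ≤ 1 / 2)
    (hdist : ∀ x ∈ ball (0 : E) R, ‖g x - x‖ ≤ 1 / 2) :
    closedBall 0 (R - 2) ⊆ g '' ball 0 R := by
  intro y hy
  have hsub : closedBall y 1 ⊆ ball (0 : E) R :=
    closedBall_subset_ball' (by linarith [mem_closedBall.1 hy])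
  have approx : ApproximatesLinearOn g (ContinuousLinearMap.id ℝ E) (ball 0 R) (1 / 2) :=
    approximatesLinearOn_id_of_norm_fderiv_sub_le (convex_ball 0 R) hg (by simpa using hD)
  have surj := approx.surjOn_closedBall_of_nonlinearRightInverse
    ⟨id, 1, fun _ => by simp, fun _ => rfl⟩ zero_le_one hsub
  have hy_mem : y ∈ closedBall (g y) ((((1 : NNReal) : ℝ)⁻¹ - ((1 / 2 : NNReal) : ℝ)) * 1) := by
    rw [mem_closedBall_iff_norm, norm_sub_rev]
    exact (hdist y (hsub (mem_closedBall_self zero_le_one))).trans (by norm_num)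
  obtain ⟨x, hx, hxy⟩ := surj hy_mem
  exact ⟨x, hsub hx, hxy⟩

theorem eventually_norm_fderiv_sub_id_lt {P : Type*} [NormedAddCommGroup P]
    [NormedSpace ℝ P] {f : P × E → E} (hf : ContDiff ℝ 1 f) (h0 : ∀ x, f (0, x) = x)
    {K : Set E} (hK : IsCompact K) {C : ℝ} (hC : 0 < C) :
    ∀ᶠ μ in 𝓝 (0 : P), ∀ x ∈ K,
      ‖fderiv ℝ (fun y => f (μ, y)) x - ContinuousLinearMap.id ℝ E‖ < C := by
  have partial_fderiv : ∀ μ x, fderiv ℝ (fun y => f (μ, y)) x =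
      (fderiv ℝ f (μ, x)).comp (ContinuousLinearMap.inr ℝ P E) := fun μ x =>
    ((hf.differentiable one_ne_zero (μ, x)).hasFDerivAt.comp x
      (hasFDerivAt_prodMk_right μ x)).fderiv
  have fderiv_zero : ∀ x, fderiv ℝ (fun y => f (0, y)) x = ContinuousLinearMap.id ℝ E :=
    fun x => by simp only [h0, fderiv_fun_id]
  refine hK.eventually_forall_of_forall_eventually fun x _ => ?_
  have hcont : Continuous fun z : P × E =>
      ‖fderiv ℝ (fun y => f (z.1, y)) z.2 - ContinuousLinearMap.id ℝ E‖ := by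
    simp only [partial_fderiv]
    exact (((hf.continuous_fderiv one_ne_zero).clm_comp continuous_const).sub
      continuous_const).norm
  exact hcont.continuousAt.eventually_lt continuousAt_const (by simpa [fderiv_zero] using hC)

end NearIdentity

/-! ### The integrator -/

section SmallStep

variable {d : ℕ} {α : ℝ → Coord d → Coord d → Coord d} {H : Coord d → ℝ} {c : ℝ → ℝ → ℝ}

theorem isDiffeoOnto_graphD {f : Coord d × Coord d → Coord d} {S : Coord d → ℝ}
    {W : Set (Coord d)} (hf : ContDiff ℝ ∞ f) (hS : ContDiff ℝ ∞ (differential S))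
    (hopen : IsOpen ((fun x => f (x, differential S x)) '' W))
    (hinv : ∃ s, ContDiffOn ℝ ∞ s ((fun x => f (x, differential S x)) '' W) ∧
      ∀ x ∈ W, s (f (x, differential S x)) = x) : IsDiffeoOnto f (graphD S W) := by
  obtain ⟨s, s_smooth, hs⟩ := hinv
  rw [IsDiffeoOnto, graphD, Set.image_image]
  refine ⟨hf, hopen, fun y => (s y, differential S (s y)),
    s_smooth.prodMk (hS.comp_contDiffOn s_smooth), ?_⟩
  rintro _ ⟨x, hx, rfl⟩
  simp only [hs x hx]

theorem contDiff_differential_hjTrunc (hs : SmoothAtSection α H) (m : ℕ) :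
    ContDiff ℝ ∞ fun z : (ℝ × ℝ) × Coord d =>
      differential (hjTrunc α H z.1.2 0 m z.1.1) z.2 :=
  contDiff_iff_contDiffAt.2 fun _ =>
    contDiffAt_spatialDifferential (contDiff_hjTrunc hs m).contDiffAt (by simp)

theorem lagr_eq_graphD (hs : SmoothAtSection α H) (hc : ∀ ε, ContDiff ℝ ∞ (c ε)) (m : ℕ)
    (W : Set (Coord d)) (ε h : ℝ) :
    lagr α H c m W ε h = graphD (hjTrunc α H ε 0 m h) W :=
  Set.image_congr fun x _ => by rw [differential_hjTrunc hs ε (hc ε)]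

theorem SmoothAtSection.eventually_isDiffeoOnto_lagr (hs : SmoothAtSection α H)
    (hc : ∀ ε, ContDiff ℝ ∞ (c ε)) (m : ℕ) (R : ℝ) {a : ℝ → Coord d × Coord d → Coord d}
    (ha : ContDiff ℝ ∞ fun w : ℝ × (Coord d × Coord d) => a w.1 w.2) (ha0 : ∀ z, a 0 z = z.1) :
    ∀ᶠ μ : ℝ × ℝ in 𝓝 0,
      IsDiffeoOnto (a μ.2) (lagr α H c m (Metric.ball 0 R) μ.2 μ.1) ∧
      Metric.closedBall 0 (R - 2) ⊆ a μ.2 '' lagr α H c m (Metric.ball 0 R) μ.2 μ.1 := by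
  have dS_smooth := contDiff_differential_hjTrunc hs m
  let f : (ℝ × ℝ) × Coord d → Coord d := fun z =>
    a z.1.2 (z.2, differential (hjTrunc α H z.1.2 0 m z.1.1) z.2)
  have hf : ContDiff ℝ ∞ f :=
    ha.comp (f := fun z : (ℝ × ℝ) × Coord d =>
      (z.1.2, z.2, differential (hjTrunc α H z.1.2 0 m z.1.1) z.2))
      (contDiff_fst.snd.prodMk (contDiff_snd.prodMk dS_smooth))
  have f_zero : ∀ x, f (0, x) = x := fun x => ha0 _
  filter_upwards [eventually_norm_fderiv_sub_id_lt (hf.of_le (by simp)) f_zero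
    (isCompact_closedBall (0 : Coord d) R) (half_pos one_pos),
    eventually_norm_sub_self_lt hf.continuous f_zero (isCompact_closedBall (0 : Coord d) R)
      (half_pos one_pos)] with μ fderiv_near dist_near
  have fμ_smooth : ContDiff ℝ ∞ fun x => f (μ, x) := hf.comp (contDiff_const.prodMk contDiff_id)
  have fderiv_le : ∀ x ∈ Metric.ball 0 R,
      ‖fderiv ℝ (fun x => f (μ, x)) x - ContinuousLinearMap.id ℝ (Coord d)‖ ≤ 1 / 2 :=
    fun x hx => (fderiv_near x (Metric.ball_subset_closedBall hx)).le
  obtain ⟨hopen, hinv⟩ := exists_contDiffOn_leftInverse_of_near_id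
    (NNReal.half_lt_self one_ne_zero) fμ_smooth Metric.isOpen_ball (convex_ball 0 R)
    (by simpa using fderiv_le)
  rw [lagr_eq_graphD hs hc]
  refine ⟨isDiffeoOnto_graphD (ha.comp (contDiff_const.prodMk contDiff_id))
    (dS_smooth.comp (contDiff_const.prodMk contDiff_id)) hopen hinv, ?_⟩
  rw [graphD, Set.image_image]
  exact closedBall_subset_image_of_near_id (fun x _ => fμ_smooth.differentiable (by simp) x)
    fderiv_le fun x hx => (dist_near x (Metric.ball_subset_closedBall hx)).le

end SmallStep

section Truncations

variable {d : ℕ} {π : Coord d → Matrix (Fin d) (Fin d) ℝ} {U : Set (ℝ × Coord d × Coord d)}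
  {α : ℝ → Coord d → Coord d → Coord d}

theorem alphaHat_reflect (n : ℕ) (ε : ℝ) (z : Coord d × Coord d) :
    alphaHat α n ε (reflect z) = betaHat α n ε z := rfl

theorem betaHat_reflect (n : ℕ) (ε : ℝ) (z : Coord d × Coord d) :
    betaHat α n ε (reflect z) = alphaHat α n ε z := by
  rw [← alphaHat_reflect, reflect, reflect, neg_neg]

theorem IsKarasevMap.contDiff_alphaHat (hα : IsKarasevMap π U α) (n : ℕ) :
    ContDiff ℝ ∞ fun w : ℝ × (Coord d × Coord d) => alphaHat α n w.1 w.2 := by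
  have hs : SmoothAtZero fun w : ℝ × (Coord d × Coord d) => α w.1 w.2.1 w.2.2 := fun z =>
    hα.smooth.contDiffAt (hα.isOpen.mem_nhds (hα.zero_mem z.1 z.2))
  unfold alphaHat truncation
  refine ContDiff.sum fun k _ => ContDiff.fun_smul ?_ ((contDiff_jet hs k).comp contDiff_snd)
  fun_prop

theorem IsKarasevMap.contDiff_betaHat (hα : IsKarasevMap π U α) (n : ℕ) :
    ContDiff ℝ ∞ fun w : ℝ × (Coord d × Coord d) => betaHat α n w.1 w.2 :=
  (hα.contDiff_alphaHat n).comp (contDiff_fst.prodMk (contDiff_reflect.comp contDiff_snd))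

theorem IsKarasevMap.apply_time_zero (hα : IsKarasevMap π U α) (x p : Coord d) :
    α 0 x p = x := by
  obtain ⟨_, _, _, average⟩ := hα.relation 0 x p (hα.zero_mem x p)
  exact (average.trans (if_pos rfl)).symm

theorem IsKarasevMap.alphaHat_zero (hα : IsKarasevMap π U α) (n : ℕ) (z : Coord d × Coord d) :
    alphaHat α n 0 z = z.1 := by
  rw [alphaHat, truncation, Finset.sum_range_succ']
  simp [hα.apply_time_zero]

theorem IsKarasevMap.smoothAtSection (hα : IsKarasevMap π U α) {H : Coord d → ℝ}
    (hH : ContDiff ℝ ∞ H) : SmoothAtSection α H := fun ε x =>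
  hH.contDiffAt.comp (ε, x, 0)
    (hα.smooth.contDiffAt (hα.isOpen.mem_nhds (hα.section_mem ε x)))

theorem IsKarasevMap.exists_isLocalBisection (hα : IsKarasevMap π U α) {H : Coord d → ℝ}
    (hH : ContDiff ℝ ∞ H) {c : ℝ → ℝ → ℝ} (hc : ∀ ε, ContDiff ℝ ∞ (c ε)) (n m : ℕ)
    {K : Set (Coord d)} (hK : IsCompact K) :
    ∃ W : Set (Coord d), IsOpen W ∧ K ⊆ W ∧ ∃ δ > 0, ∀ ε h : ℝ, |ε| < δ → |h| < δ →
      IsLocalBisection (alphaHat α n ε) (betaHat α n ε) (lagr α H c m W ε h) ∧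
      K ⊆ khjDomain α H c n m W ε h := by
  have hs := hα.smoothAtSection hH
  obtain ⟨r, hr⟩ := hK.isBounded.subset_closedBall (0 : Coord d)
  obtain ⟨δ, δ_pos, hδ⟩ := Metric.eventually_nhds_iff_ball.1
    ((hs.eventually_isDiffeoOnto_lagr hc m (r + 2) (hα.contDiff_alphaHat n)
      (hα.alphaHat_zero n)).and
    (hs.eventually_isDiffeoOnto_lagr hc m (r + 2) (hα.contDiff_betaHat n)
      fun z => hα.alphaHat_zero n (reflect z)))
  refine ⟨Metric.ball 0 (r + 2), Metric.isOpen_ball,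
    hr.trans (Metric.closedBall_subset_ball (by linarith)), δ, δ_pos, fun ε h hε hh => ?_⟩
  obtain ⟨⟨source, _⟩, target, subset_image⟩ := hδ (h, ε) <| by
    rw [mem_ball_zero_iff, Prod.norm_def]
    exact max_lt hh hε
  rw [add_sub_cancel_right] at subset_image
  exact ⟨⟨source, target⟩, hr.trans subset_image⟩

end Truncations

section Reflection

variable {d : ℕ} {a b f g : Coord d × Coord d → Coord d} {L : Set (Coord d × Coord d)}
  {z : Coord d × Coord d}

theorem image_image_reflect (hfg : ∀ z, g (reflect z) = f z) (L : Set (Coord d × Coord d)) :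
    g '' (reflect '' L) = f '' L := by
  simp only [Set.image_image, hfg]

theorem IsDiffeoOnto.injOn (h : IsDiffeoOnto f L) : Set.InjOn f L := by
  obtain ⟨_, _, s, _, hs⟩ := h
  exact Set.LeftInvOn.injOn hs

theorem IsDiffeoOnto.image_reflect (h : IsDiffeoOnto f L) (hg : ContDiff ℝ ∞ g)
    (hfg : ∀ z, g (reflect z) = f z) : IsDiffeoOnto g (reflect '' L) := by
  obtain ⟨_, hopen, s, s_smooth, hs⟩ := h
  rw [IsDiffeoOnto, image_image_reflect hfg]
  refine ⟨hg, hopen, reflect ∘ s, contDiff_reflect.comp_contDiffOn s_smooth, ?_⟩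
  rintro _ ⟨z, hz, rfl⟩
  rw [hfg, Function.comp_apply, hs z hz]

theorem IsLocalBisection.image_reflect (h : IsLocalBisection a b L)
    (hab : ∀ z, a (reflect z) = b z) (hba : ∀ z, b (reflect z) = a z) :
    IsLocalBisection a b (reflect '' L) :=
  ⟨h.2.image_reflect h.1.1 hab, h.1.image_reflect h.2.1 hba⟩

theorem inducedMap_apply (hb : Set.InjOn b L) (hz : z ∈ L) : inducedMap a b L (b z) = a z := by
  rw [inducedMap, hb.leftInvOn_invFunOn hz]

theorem inducedMap_image_reflect_apply (h : IsLocalBisection a b L)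
    (hab : ∀ z, a (reflect z) = b z) (hba : ∀ z, b (reflect z) = a z) (hz : z ∈ L) :
    inducedMap a b (reflect '' L) (a z) = b z := by
  rw [← hba z, inducedMap_apply (h.image_reflect hab hba).2.injOn (Set.mem_image_of_mem _ hz), hab]

theorem invOn_inducedMap_image_reflect (h : IsLocalBisection a b L)
    (hab : ∀ z, a (reflect z) = b z) (hba : ∀ z, b (reflect z) = a z) :
    Set.InvOn (inducedMap a b L) (inducedMap a b (reflect '' L)) (a '' L) (b '' L) := by
  constructor <;> rintro _ ⟨z, hz, rfl⟩
  · rw [inducedMap_image_reflect_apply h hab hba hz, inducedMap_apply h.2.injOn hz]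
  · rw [inducedMap_apply h.2.injOn hz, inducedMap_image_reflect_apply h hab hba hz]

theorem mapsTo_inducedMap (hb : Set.InjOn b L) :
    Set.MapsTo (inducedMap a b L) (b '' L) (a '' L) := by
  rintro _ ⟨z, hz, rfl⟩
  exact ⟨z, hz, (inducedMap_apply hb hz).symm⟩

end Reflection

section SelfAdjointness

variable {d : ℕ} {π : Coord d → Matrix (Fin d) (Fin d) ℝ} {U : Set (ℝ × Coord d × Coord d)}
  {α : ℝ → Coord d → Coord d → Coord d} {H : Coord d → ℝ} {c : ℝ → ℝ → ℝ} {n m : ℕ}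
  {W : Set (Coord d)} {ε h : ℝ}

section ReflectedLagrangian

variable (hneg : lagr α H c m W ε (-h) = reflect '' lagr α H c m W ε h)
  (hL : IsLocalBisection (alphaHat α n ε) (betaHat α n ε) (lagr α H c m W ε h))

include hneg

theorem khjDomain_neg :
    khjDomain α H c n m W ε (-h) = alphaHat α n ε '' lagr α H c m W ε h := by
  rw [khjDomain, hneg, image_image_reflect (betaHat_reflect n ε)]

include hL

theorem isLocalBisection_lagr_neg :
    IsLocalBisection (alphaHat α n ε) (betaHat α n ε) (lagr α H c m W ε (-h)) :=
  hneg ▸ hL.image_reflect (alphaHat_reflect n ε) (betaHat_reflect n ε)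

theorem invOn_khjMap_neg :
    Set.InvOn (khjMap α H c n m W ε h) (khjMap α H c n m W ε (-h))
      (khjDomain α H c n m W ε (-h)) (khjDomain α H c n m W ε h) := by
  rw [khjDomain_neg hneg, khjMap, khjMap, hneg]
  exact invOn_inducedMap_image_reflect hL (alphaHat_reflect n ε) (betaHat_reflect n ε)

theorem mapsTo_khjMap :
    Set.MapsTo (khjMap α H c n m W ε h) (khjDomain α H c n m W ε h)
      (khjDomain α H c n m W ε (-h)) :=
  khjDomain_neg hneg ▸ mapsTo_inducedMap hL.2.injOn

theorem mapsTo_khjMap_neg :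
    Set.MapsTo (khjMap α H c n m W ε (-h)) (khjDomain α H c n m W ε (-h))
      (khjDomain α H c n m W ε h) := by
  have image_neg : alphaHat α n ε '' lagr α H c m W ε (-h) = khjDomain α H c n m W ε h := by
    rw [hneg, image_image_reflect (alphaHat_reflect n ε), khjDomain]
  exact image_neg ▸ mapsTo_inducedMap (isLocalBisection_lagr_neg hneg hL).2.injOn

theorem bijOn_khjMap_neg :
    Set.BijOn (khjMap α H c n m W ε (-h)) (khjDomain α H c n m W ε (-h))
      (khjDomain α H c n m W ε h) :=
  (invOn_khjMap_neg hneg hL).bijOn (mapsTo_khjMap_neg hneg hL) (mapsTo_khjMap hneg hL)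

theorem eqOn_adjointMethod_khjMap :
    Set.EqOn (adjointMethod (khjMap α H c n m W ε) (khjDomain α H c n m W ε) h)
      (khjMap α H c n m W ε h) (khjDomain α H c n m W ε h) :=
  Set.eqOn_of_leftInvOn_of_rightInvOn (bijOn_khjMap_neg hneg hL).invOn_invFunOn.1
    (invOn_khjMap_neg hneg hL).2 (mapsTo_khjMap hneg hL)

omit hL in
theorem isBisection_lagr_neg
    (hL : IsBisection (alphaHat α n ε) (betaHat α n ε) (lagr α H c m W ε h)) :
    IsBisection (alphaHat α n ε) (betaHat α n ε) (lagr α H c m W ε (-h)) := by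
  refine ⟨isLocalBisection_lagr_neg hneg hL.1, ?_, (khjDomain_neg hneg).trans hL.2.1⟩
  rw [hneg, image_image_reflect (alphaHat_reflect n ε), hL.2.2]

end ReflectedLagrangian

theorem IsKarasevMap.lagr_neg (hα : IsKarasevMap π U α) (hπ : IsPoissonTensor π)
    (hH : ContDiff ℝ ∞ H) (hc : ∀ ε, ContDiff ℝ ∞ (c ε)) (m : ℕ) (W : Set (Coord d)) (ε h : ℝ) :
    lagr α H c m W ε (-h) = reflect '' lagr α H c m W ε h := by
  rw [lagr, lagr, graphD, graphD, Set.image_image]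
  refine Set.image_congr fun x _ => Prod.ext rfl ?_
  exact differential_hjTrunc_neg (hα.smoothAtSection hH)
    (IsKarasevMap.canonicalBracket_eq_zero hπ hα (hH.differentiable (by simp)) ε) (hc ε) m h x

end SelfAdjointness

end KHJ

theorem mainTheorem4 (d : ℕ) (π : KHJ.Coord d → Matrix (Fin d) (Fin d) ℝ)
    (hπ : KHJ.IsPoissonTensor π) (H : KHJ.Coord d → ℝ) (hH : ContDiff ℝ ∞ H) :
    -- the Karasev map exists
    (∃ U α, KHJ.IsKarasevMap π U α) ∧
    ∀ U α, KHJ.IsKarasevMap π U α →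
    ∀ c : ℝ → ℝ → ℝ, (∀ ε, ContDiff ℝ ∞ (c ε)) → ∀ n m : ℕ,
      -- `Ŝ` is the order `m` Taylor truncation of every exact Hamilton-Jacobi solution
      (∀ ε N S, KHJ.IsHJSolution U α H ε (c ε) N S → ∀ h x,
        KHJ.hjTrunc α H ε (c ε) m h x =
          ∑ l ∈ Finset.range (m + 1),
            h ^ l / (l.factorial : ℝ) * iteratedDeriv l (fun t => S t x) 0) ∧
      -- for small `ε`, `h` the integrator is well defined on a given compact set
      (∀ K : Set (KHJ.Coord d), IsCompact K →
        ∃ W : Set (KHJ.Coord d), IsOpen W ∧ K ⊆ W ∧ ∃ δ > 0, ∀ ε h : ℝ, |ε| < δ → |h| < δ →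
          KHJ.IsLocalBisection (KHJ.alphaHat α n ε) (KHJ.betaHat α n ε)
            (KHJ.lagr α H c m W ε h) ∧
          K ⊆ KHJ.khjDomain α H c n m W ε h) ∧
      -- self-adjointness wherever the integrator is defined by a local bisection
      (∀ (W : Set (KHJ.Coord d)) (ε h : ℝ), IsOpen W →
        KHJ.IsLocalBisection (KHJ.alphaHat α n ε) (KHJ.betaHat α n ε)
          (KHJ.lagr α H c m W ε h) →
        KHJ.IsLocalBisection (KHJ.alphaHat α n ε) (KHJ.betaHat α n ε)
          (KHJ.lagr α H c m W ε (-h)) ∧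
        Set.BijOn (KHJ.khjMap α H c n m W ε (-h))
          (KHJ.khjDomain α H c n m W ε (-h)) (KHJ.khjDomain α H c n m W ε h) ∧
        Set.EqOn
          (KHJ.adjointMethod (KHJ.khjMap α H c n m W ε) (KHJ.khjDomain α H c n m W ε) h)
          (KHJ.khjMap α H c n m W ε h) (KHJ.khjDomain α H c n m W ε h)) ∧
      -- self-adjointness as diffeomorphisms of `ℝ^d` in the case of a global bisection
      (∀ ε h : ℝ,
        KHJ.IsBisection (KHJ.alphaHat α n ε) (KHJ.betaHat α n ε)
          (KHJ.lagr α H c m Set.univ ε h) →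
        KHJ.IsBisection (KHJ.alphaHat α n ε) (KHJ.betaHat α n ε)
          (KHJ.lagr α H c m Set.univ ε (-h)) ∧
        Function.Bijective (KHJ.khjMap α H c n m Set.univ ε (-h)) ∧
        Function.LeftInverse (KHJ.khjMap α H c n m Set.univ ε h)
          (KHJ.khjMap α H c n m Set.univ ε (-h)) ∧
        Function.RightInverse (KHJ.khjMap α H c n m Set.univ ε h)
          (KHJ.khjMap α H c n m Set.univ ε (-h))) := by
  refine ⟨KHJ.exists_isKarasevMap hπ.smooth, fun U α hα c hc n m => ⟨?_, ?_, ?_, ?_⟩⟩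
  · exact fun ε N S hS h x => hS.hjTrunc_eq_taylor (hα.smoothAtSection hH) (hc ε) m h x
  · exact fun K hK => hα.exists_isLocalBisection hH hc n m hK
  · intro W ε h _ hL
    have hneg := hα.lagr_neg hπ hH hc m W ε h
    exact ⟨KHJ.isLocalBisection_lagr_neg hneg hL, KHJ.bijOn_khjMap_neg hneg hL,
      KHJ.eqOn_adjointMethod_khjMap hneg hL⟩
  · intro ε h hL
    have hneg := hα.lagr_neg hπ hH hc m Set.univ ε h
    have hLneg := KHJ.isBisection_lagr_neg hneg hL
    have inverse := KHJ.invOn_khjMap_neg hneg hL.1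
    rw [KHJ.khjDomain, KHJ.khjDomain, hLneg.2.2, hL.2.2] at inverse
    have left : Function.LeftInverse _ _ := fun x => inverse.1 (Set.mem_univ x)
    have right : Function.RightInverse _ _ := fun x => inverse.2 (Set.mem_univ x)
    exact ⟨hLneg, ⟨left.injective, right.surjective⟩, left, right⟩
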